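/- Let $\mathcal C$ be a braided monoidal category with tensor product $\otimes$, unit object $K$ and braiding $c$, in which every idempotent splits (associativity and unit constraints are suppressed; for an object $X$ write $X$ also for $id_X$). **Definitions.** A *unital magma* $(A,\eta_A,\mu_A)$ satisfies $\mu_A(\eta_A\otimes A)=id_A=\mu_A(A\otimes\eta_A)$; associativity is not required. For a comonoid $D$, a unital magma $A$ and $f,g:D\to A$ put $f*g=\mu_A(f\otimes g)\delta_D$. A *weak Hopf quasigroup* is a unital magma $(H,\eta_H,\mu_H)$ that is also a (coassociative, counital) comonoid $(H,\varepsilon_H,\delta_H)$, with a morphism $\lambda_H:H\to H$, such that, with $\Pi^L_H=id_H*\lambda_H$ and $\Pi^R_H=\lambda_H*id_H$, 1. $\delta_H\mu_H=(\mu_H\otimes\mu_H)(H\otimes c_{H,H}\otimes H)(\delta_H\otimes\delta_H)$; 2. $\varepsilon_H\mu_H(\mu_H\otimes H)=\varepsilon_H\mu_H(H\otimes\mu_H)=(\varepsilon_H\mu_H\otimes\varepsilon_H\mu_H)(H\otimes\delta_H\otimes H)=(\varepsilon_H\mu_H\otimes\varepsilon_H\mu_H)(H\otimes c_{H,H}^{-1}\delta_H\otimes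 H)$; 3. $(\delta_H\otimes H)\delta_H\eta_H=(H\otimes\mu_H\otimes H)(\delta_H\eta_H\otimes\delta_H\eta_H)=(H\otimes\mu_Hc_{H,H}^{-1}\otimes H)(\delta_H\eta_H\otimes\delta_H\eta_H)$; 4. $\Pi^L_H=(\varepsilon_H\mu_H\otimes H)(H\otimes c_{H,H})(\delta_H\eta_H\otimes H)$ and $\Pi^R_H=(H\otimes\varepsilon_H\mu_H)(c_{H,H}\otimes H)(H\otimes\delta_H\eta_H)$; 5. $\lambda_H*\Pi^L_H=\Pi^R_H*\lambda_H=\lambda_H$; 6. $\mu_H(\lambda_H\otimes\mu_H)(\delta_H\otimes H)=\mu_H(\Pi^R_H\otimes H)$ and $\mu_H(H\otimes\mu_H)(H\otimes\lambda_H\otimes H)(\delta_H\otimes H)=\mu_H(\Pi^L_H\otimes H)$; 7. $\mu_H(\mu_H\otimes\lambda_H)(H\otimes\delta_H)=\mu_H(H\otimes\Pi^L_H)$ and $\mu_H(\mu_H\otimes H)(H\otimes\lambda_H\otimes H)(H\otimes\delta_H)=\mu_H(H\otimes\Pi^R_H)$. A *right $H$-comodule magma* is a unital magma $B$ with a right $H$-comodule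 structure $\rho_B:B\to B\otimes H$ such that $(\mu_B\otimes\mu_H)(B\otimes c_{H,B}\otimes H)(\rho_B\otimes\rho_B)=\rho_B\mu_B$ and $(B\otimes\Pi^L_H)\rho_B\eta_B=\rho_B\eta_B$. An *anchor morphism* is a morphism $h:H\to B$ of right $H$-comodules and of unital magmas such that $$\mu_B(\mu_B(B\otimes h)\otimes h\lambda_H)(B\otimes\delta_H)=\mu_B(B\otimes h\Pi^L_H),\qquad \mu_B(\mu_B(B\otimes h\lambda_H)\otimes h)(B\otimes\delta_H)=\mu_B(B\otimes h\Pi^R_H).$$ Given $\phi_M:M\otimes B\to M$ and $\rho_M:M\to M\otimes H$, put $q_M=\phi_M(M\otimes h\lambda_H)\rho_M$; in particular $q_B=\mu_B(B\otimes h\lambda_H)\rho_B$. When $q_M$ is idempotent, write $q_M=i_Mp_M$, $p_Mi_M=id_{M^{coH}}$ for a splitting through $M^{coH}$; likewise $q_B=i_Bp_B$, $p_Bi_B=id_{B^{coH}}$. A *strong $(H,B,h)$-Hopf module* is a right $H$-comodule $(M,\rho_M)$ with a morphism $\phi_M:M\otimes B\to M$ such that * $\phi_M(M\otimes\eta_B)=id_M$;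 * $\phi_M(\phi_M(M\otimes i_B)\otimes B)=\phi_M(M\otimes\mu_B(i_B\otimes B))$; * $\rho_M\phi_M=(\phi_M\otimes\mu_H)(M\otimes c_{H,B}\otimes H)(\rho_M\otimes\rho_B)$; * $\phi_M(\phi_M(M\otimes h)\otimes h\lambda_H)(M\otimes\delta_H)=\phi_M(M\otimes h\Pi^L_H)$; * $\phi_M(\phi_M(M\otimes h\lambda_H)\otimes h)(M\otimes\delta_H)=\phi_M(M\otimes h\Pi^R_H)$. **Proposition.** Let $H$ be a weak Hopf quasigroup in $\mathcal C$, $(B,\rho_B)$ a right $H$-comodule magma and $h:H\to B$ an anchor morphism. Suppose that $\mathcal C$ has coequalizers and that the functors $-\otimes B$ and $-\otimes H$ preserve them. Then $q_B$ is a split idempotent. For any splitting of $q_B$, assume that $$\mu_B(\mu_B(B\otimes i_B)\otimes B)=\mu_B(B\otimes\mu_B(i_B\otimes B)),\qquad \mu_B(i_B\otimes\mu_B)=\mu_B(\mu_B(i_B\otimes B)\otimes B).$$ Let $(M,\phi_M,\rho_M)$ be a strong $(H,B,h)$-Hopf module. Then $q_M$ is a split idempotent and, for any splitting of it, the following hold.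 (i) The morphism $\phi_{M^{coH}}=p_M\phi_M(i_M\otimes i_B)$ satisfies $i_M\phi_{M^{coH}}=\phi_M(i_M\otimes i_B)$. Let $n:M^{coH}\otimes B\to M^{coH}\otimes_{B^{coH}}B$ be the coequalizer of $\phi_{M^{coH}}\otimes B$ and $M^{coH}\otimes\mu_B(i_B\otimes B)$, and put $T=M^{coH}\otimes_{B^{coH}}B$. (ii) There are unique morphisms $\phi_T:T\otimes B\to T$, $\rho_T:T\to T\otimes H$ and $\omega_M:T\to M$ with $$\phi_T(n\otimes B)=n(M^{coH}\otimes\mu_B),\qquad \rho_Tn=(n\otimes H)(M^{coH}\otimes\rho_B),\qquad \omega_Mn=\phi_M(i_M\otimes B).$$ (iii) $(T,\phi_T,\rho_T)$ is a strong $(H,B,h)$-Hopf module. (iv) $\omega_M:T\to M$ is an isomorphism of right $H$-comodules, with inverse $n(p_M\otimes h)\rho_M$. -/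

import Mathlib

open CategoryTheory MonoidalCategory Limits

universe v u

namespace DoiHopf

section Magmas

variable {C : Type u} [Category.{v} C] [MonoidalCategory C]

/-- A unital magma in a monoidal category: no associativity is required. -/
class UnitalMagma (A : C) where
  /-- the unit -/
  one : 𝟙_ C ⟶ A
  /-- the product -/
  mul : A ⊗ A ⟶ A
  one_mul : one ▷ A ≫ mul = (λ_ A).hom
  mul_one : A ◁ one ≫ mul = (ρ_ A).hom

/-- The unit of a unital magma. -/
abbrev eta (A : C) [UnitalMagma A] : 𝟙_ C ⟶ A := UnitalMagma.one

/-- The product of a unital magma. -/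
abbrev mu (A : C) [UnitalMagma A] : A ⊗ A ⟶ A := UnitalMagma.mul

/-- The counit of a comonoid. -/
abbrev eps (D : C) [ComonObj D] : D ⟶ 𝟙_ C := ComonObj.counit

/-- The coproduct of a comonoid. -/
abbrev delta (D : C) [ComonObj D] : D ⟶ D ⊗ D := ComonObj.comul

/-- The convolution product of two morphisms from a comonoid to a unital magma. -/
def conv {D A : C} [ComonObj D] [UnitalMagma A] (f g : D ⟶ A) : D ⟶ A :=
  delta D ≫ (f ⊗ₘ g) ≫ mu A

/-- `ρ` is a right coaction of the comonoid `D` on `M`. -/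
structure IsComodule (D : C) [ComonObj D] (M : C) (ρ : M ⟶ M ⊗ D) : Prop where
  counit : ρ ≫ M ◁ eps D = (ρ_ M).inv
  coassoc : ρ ≫ ρ ▷ D ≫ (α_ M D D).hom = ρ ≫ M ◁ delta D

/-- `f` is a morphism of right `D`-comodules from `(M, ρM)` to `(N, ρN)`. -/
def IsComoduleHom {D M N : C} (ρM : M ⟶ M ⊗ D) (ρN : N ⟶ N ⊗ D) (f : M ⟶ N) : Prop :=
  ρM ≫ f ▷ D = f ≫ ρN

/-- A factorization `q = i ∘ p`, `p ∘ i = id`, of an endomorphism `q` of `X`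
(so `q` is idempotent and `obj` is its image). -/
structure Splitting {X : C} (q : X ⟶ X) where
  /-- the image of `q` -/
  obj : C
  /-- the inclusion -/
  i : obj ⟶ X
  /-- the projection -/
  p : X ⟶ obj
  i_p : i ≫ p = 𝟙 obj
  p_i : p ≫ i = q

end Magmas

section Quasigroups

variable {C : Type u} [Category.{v} C] [MonoidalCategory C] [BraidedCategory C]

/-- A weak Hopf quasigroup in a braided monoidal category. The operation `⊗≫` is composition
with the associativity and unit constraints inserted, and `tensorμ W X Y Z` is the
morphism `W ⊗ c_{X,Y} ⊗ Z`. -/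
class WeakHopfQuasigroup (H : C) extends UnitalMagma H, ComonObj H where
  /-- the antipode -/
  antipode : H ⟶ H
  mul_comul : mu H ≫ delta H =
    (delta H ⊗ₘ delta H) ≫ tensorμ H H H H ≫ (mu H ⊗ₘ mu H)
  eps_mul_assoc : mu H ▷ H ≫ mu H ≫ eps H = (α_ H H H).hom ≫ H ◁ mu H ≫ mu H ≫ eps H
  eps_mul_split : mu H ▷ H ≫ mu H ≫ eps H =
    𝟙 ((H ⊗ H) ⊗ H) ⊗≫ H ◁ delta H ▷ H ⊗≫
      ((mu H ≫ eps H) ⊗ₘ (mu H ≫ eps H)) ⊗≫ 𝟙 (𝟙_ C)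
  eps_mul_split' : mu H ▷ H ≫ mu H ≫ eps H =
    𝟙 ((H ⊗ H) ⊗ H) ⊗≫ H ◁ (delta H ≫ (β_ H H).inv) ▷ H ⊗≫
      ((mu H ≫ eps H) ⊗ₘ (mu H ≫ eps H)) ⊗≫ 𝟙 (𝟙_ C)
  delta_eta : eta H ≫ delta H ≫ delta H ▷ H =
    𝟙 (𝟙_ C) ⊗≫ ((eta H ≫ delta H) ⊗ₘ (eta H ≫ delta H)) ⊗≫ (H ◁ mu H) ▷ H
  delta_eta' : eta H ≫ delta H ≫ delta H ▷ H =
    𝟙 (𝟙_ C) ⊗≫ ((eta H ≫ delta H) ⊗ₘ (eta H ≫ delta H)) ⊗≫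
      (H ◁ ((β_ H H).inv ≫ mu H)) ▷ H
  target_eq : conv (𝟙 H) antipode =
    𝟙 H ⊗≫ (eta H ≫ delta H) ▷ H ⊗≫ H ◁ (β_ H H).hom ⊗≫ (mu H ≫ eps H) ▷ H ⊗≫ 𝟙 H
  source_eq : conv antipode (𝟙 H) =
    𝟙 H ⊗≫ H ◁ (eta H ≫ delta H) ⊗≫ (β_ H H).hom ▷ H ⊗≫ H ◁ (mu H ≫ eps H) ⊗≫ 𝟙 H
  antipode_target : conv antipode (conv (𝟙 H) antipode) = antipode
  source_antipode : conv (conv antipode (𝟙 H)) antipode = antipode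
  antipode_mul_left : delta H ▷ H ≫ (α_ H H H).hom ≫ (antipode ⊗ₘ mu H) ≫ mu H =
    conv antipode (𝟙 H) ▷ H ≫ mu H
  mul_antipode_left :
    delta H ▷ H ≫ (α_ H H H).hom ≫ H ◁ (antipode ▷ H) ≫ H ◁ mu H ≫ mu H =
      conv (𝟙 H) antipode ▷ H ≫ mu H
  mul_antipode_right : H ◁ delta H ≫ (α_ H H H).inv ≫ (mu H ⊗ₘ antipode) ≫ mu H =
    H ◁ conv (𝟙 H) antipode ≫ mu H
  antipode_mul_right :
    H ◁ delta H ≫ (α_ H H H).inv ≫ (H ◁ antipode) ▷ H ≫ mu H ▷ H ≫ mu H =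
      H ◁ conv antipode (𝟙 H) ≫ mu H

/-- The antipode of a weak Hopf quasigroup. -/
abbrev antip (H : C) [WeakHopfQuasigroup H] : H ⟶ H := WeakHopfQuasigroup.antipode

/-- The target morphism `id ∗ λ`. -/
def piL (H : C) [WeakHopfQuasigroup H] : H ⟶ H := conv (𝟙 H) (antip H)

/-- The source morphism `λ ∗ id`. -/
def piR (H : C) [WeakHopfQuasigroup H] : H ⟶ H := conv (antip H) (𝟙 H)

/-- `(B, ρ)` is a right `H`-comodule magma. -/
structure IsComoduleMagma (H : C) [WeakHopfQuasigroup H] (B : C) [UnitalMagma B]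
    (ρ : B ⟶ B ⊗ H) : Prop where
  comodule : IsComodule H B ρ
  mul_coact : (ρ ⊗ₘ ρ) ≫ tensorμ B H B H ≫ (mu B ⊗ₘ mu H) = mu B ≫ ρ
  one_coact : eta B ≫ ρ ≫ B ◁ piL H = eta B ≫ ρ

/-- `h : H ⟶ B` is an anchor morphism: a multiplicative total integral
that satisfies two further identities. -/
structure IsAnchor {H : C} [WeakHopfQuasigroup H] {B : C} [UnitalMagma B]
    (ρ : B ⟶ B ⊗ H) (h : H ⟶ B) : Prop where
  integral : IsComoduleHom (delta H) ρ h
  total : eta H ≫ h = eta B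
  map_mul : mu H ≫ h = (h ⊗ₘ h) ≫ mu B
  mul_antipode :
    B ◁ delta H ≫ (α_ B H H).inv ≫ ((B ◁ h ≫ mu B) ⊗ₘ (antip H ≫ h)) ≫ mu B =
      B ◁ (piL H ≫ h) ≫ mu B
  antipode_mul :
    B ◁ delta H ≫ (α_ B H H).inv ≫ ((B ◁ (antip H ≫ h) ≫ mu B) ⊗ₘ h) ≫ mu B =
      B ◁ (piR H ≫ h) ≫ mu B

/-- The endomorphism `q_M = φ ∘ (M ⊗ (h ∘ λ)) ∘ ρ` of `M`. For `M = B`, `φ = μ_B`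
this is `q_B`. Its image is the object of coinvariants. -/
def coinvEnd {H : C} [WeakHopfQuasigroup H] {B M : C} (h : H ⟶ B)
    (φ : M ⊗ B ⟶ M) (ρ : M ⟶ M ⊗ H) : M ⟶ M :=
  ρ ≫ M ◁ (antip H ≫ h) ≫ φ

/-- `(M, φ, ρ)` is a strong `(H, B, h)`-Hopf module, where `sB` is a factorization of `q_B`
through the coinvariants of `B`. -/
structure IsStrongHopfModule {H : C} [WeakHopfQuasigroup H] {B : C} [UnitalMagma B]
    {ρB : B ⟶ B ⊗ H} {h : H ⟶ B} (sB : Splitting (coinvEnd h (mu B) ρB))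
    (M : C) (φ : M ⊗ B ⟶ M) (ρ : M ⟶ M ⊗ H) : Prop where
  comodule : IsComodule H M ρ
  act_one : M ◁ eta B ≫ φ = (ρ_ M).hom
  act_act : (M ◁ sB.i ≫ φ) ▷ B ≫ φ = (α_ M sB.obj B).hom ≫ M ◁ (sB.i ▷ B ≫ mu B) ≫ φ
  coact_act : φ ≫ ρ = (ρ ⊗ₘ ρB) ≫ tensorμ M H B H ≫ (φ ⊗ₘ mu H)
  act_antipode :
    M ◁ delta H ≫ (α_ M H H).inv ≫ ((M ◁ h ≫ φ) ⊗ₘ (antip H ≫ h)) ≫ φ =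
      M ◁ (piL H ≫ h) ≫ φ
  antipode_act :
    M ◁ delta H ≫ (α_ M H H).inv ≫ ((M ◁ (antip H ≫ h) ≫ φ) ⊗ₘ h) ≫ φ =
      M ◁ (piR H ≫ h) ≫ φ

section Tensor

variable {H : C} [WeakHopfQuasigroup H] {B : C} [UnitalMagma B] {ρB : B ⟶ B ⊗ H} {h : H ⟶ B}
  (sB : Splitting (coinvEnd h (mu B) ρB))
  {M : C} {φ : M ⊗ B ⟶ M} {ρ : M ⟶ M ⊗ H} (sM : Splitting (coinvEnd h φ ρ))

/-- The action of the coinvariants of `B` on the coinvariants of `M`, namely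
`p_M ∘ φ ∘ (i_M ⊗ i_B)`. -/
def coinvAct : sM.obj ⊗ sB.obj ⟶ sM.obj :=
  (sM.i ⊗ₘ sB.i) ≫ φ ≫ sM.p

/-- The first morphism of the coequalized pair, the action on the coinvariants of `M`. -/
def tensorFst : (sM.obj ⊗ sB.obj) ⊗ B ⟶ sM.obj ⊗ B :=
  coinvAct sB sM ▷ B

/-- The second morphism of the coequalized pair, multiplication in `B`. -/
def tensorSnd : (sM.obj ⊗ sB.obj) ⊗ B ⟶ sM.obj ⊗ B :=
  (α_ sM.obj sB.obj B).hom ≫ sM.obj ◁ (sB.i ▷ B ≫ mu B)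

variable [HasCoequalizers C]

/-- The tensor product of the coinvariants of `M` with `B` over the coinvariants of `B`. -/
noncomputable def coinvTensor : C := coequalizer (tensorFst sB sM) (tensorSnd sB sM)

/-- The canonical projection onto the tensor product over the coinvariants of `B`. -/
noncomputable def coinvProj : sM.obj ⊗ B ⟶ coinvTensor sB sM :=
  coequalizer.π (tensorFst sB sM) (tensorSnd sB sM)

end Tensor

end Quasigroups

end DoiHopf

open DoiHopf

/-! In Sweedler notation, with crossings suppressed, q_M(m) = m_0·hλ(m_1). Two facts drive the
proof.

First, the image of q_M consists of the m with m_0 ⊗ Π^L(m_1) = m_0 ⊗ m_1. That q_M(m) has this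
property (`coinvEnd_coact_piL`) reduces to an identity in H (`antip_coact_piL`). That such m are
fixed by q_M (`comp_coinvEnd`) follows from λΠ^L = Π^RΠ^L (`piL_antip`) and m_0·hΠ^R(m_1) = m
(`coact_piR_act`). So q_M is idempotent.

Second, q_M(m_0)·h(m_1) = m (`coact_coinvEnd_act`), which says that ω_M after n(p_M ⊗ h)ρ_M is the
identity. For the other composite, let m be coinvariant. Then ρ(m·b) = m·b_0 ⊗ b_1
(`coinv_act_coact`) and q_M(m·b) = m·q_B(b) (`coinv_act_coinvEnd`), so the class of m ⊗ b is sent to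
that of m·p_B(b_0) ⊗ h(b_1). Over the coinvariants of B this is m ⊗ q_B(b_0)h(b_1), which is m ⊗ b
by the second fact for B.

The axioms for T hold because, composed with the epimorphisms obtained from n, they become the
corresponding axioms for B acting on itself.

Calculations take place in right-nested tensor words. An operation acts on the leftmost strands in
front of an arbitrary tail Z, and left whiskering moves it to later positions. `simp` supplies the
interchange laws, and the named rewrites are the mathematical steps. -/

namespace DoiHopf

/-- `congrArg` with the equation first, so that the function elaborates against its type. -/
theorem eq_map {α β : Sort*} {a b : α} (h : a = b) (f : α → β) : f a = f b := congrArg f h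

/-! ### Operations on the leftmost strands of a tensor word -/

section Strands

variable {C : Type u} [Category.{v} C] [MonoidalCategory C]

/-- A morphism `𝟙 ⟶ X` acting on the left of `Z`. -/
def op01 {X : C} (f : 𝟙_ C ⟶ X) (Z : C) : Z ⟶ X ⊗ Z := (λ_ Z).inv ≫ f ▷ Z

/-- A morphism `X ⟶ 𝟙` acting on the left of `Z`. -/
def op10 {X : C} (f : X ⟶ 𝟙_ C) (Z : C) : X ⊗ Z ⟶ Z := f ▷ Z ≫ (λ_ Z).hom

/-- A morphism `X ⟶ Y` acting on the left of `Z`. -/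
def op11 {X Y : C} (f : X ⟶ Y) (Z : C) : X ⊗ Z ⟶ Y ⊗ Z := f ▷ Z

/-- A morphism `X ⟶ Y ⊗ W` acting on the left of `Z`. -/
def op12 {X Y W : C} (f : X ⟶ Y ⊗ W) (Z : C) : X ⊗ Z ⟶ Y ⊗ W ⊗ Z := f ▷ Z ≫ (α_ Y W Z).hom

/-- A morphism `X ⊗ Y ⟶ W` acting on the left of `Z`. -/
def op21 {X Y W : C} (f : X ⊗ Y ⟶ W) (Z : C) : X ⊗ Y ⊗ Z ⟶ W ⊗ Z := (α_ X Y Z).inv ≫ f ▷ Z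

/-- A morphism `X ⊗ Y ⟶ V ⊗ W` acting on the left of `Z`. -/
def op22 {X Y V W : C} (f : X ⊗ Y ⟶ V ⊗ W) (Z : C) : X ⊗ Y ⊗ Z ⟶ V ⊗ W ⊗ Z :=
  (α_ X Y Z).inv ≫ f ▷ Z ≫ (α_ V W Z).hom

variable {X Y V W Z Z' T : C}

-- Interchange laws, oriented so that the operation further to the right is performed first.
@[simp] theorem op01_nat (f : 𝟙_ C ⟶ X) (g : Z ⟶ Z') : op01 f Z ≫ X ◁ g = g ≫ op01 f Z' := by
  simp [op01, ← whisker_exchange]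

@[simp] theorem op10_nat (f : X ⟶ 𝟙_ C) (g : Z ⟶ Z') : op10 f Z ≫ g = X ◁ g ≫ op10 f Z' := by
  simp [op10, whisker_exchange_assoc]

@[simp] theorem op11_nat (f : X ⟶ Y) (g : Z ⟶ Z') : op11 f Z ≫ Y ◁ g = X ◁ g ≫ op11 f Z' :=
  (whisker_exchange f g).symm

@[simp] theorem op12_nat (f : X ⟶ Y ⊗ W) (g : Z ⟶ Z') :
    op12 f Z ≫ Y ◁ W ◁ g = X ◁ g ≫ op12 f Z' := by
  simp [op12, whisker_exchange_assoc]

@[simp] theorem op21_nat (f : X ⊗ Y ⟶ W) (g : Z ⟶ Z') :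
    op21 f Z ≫ W ◁ g = X ◁ Y ◁ g ≫ op21 f Z' := by
  simp [op21, ← whisker_exchange]

@[simp] theorem op22_nat (f : X ⊗ Y ⟶ V ⊗ W) (g : Z ⟶ Z') :
    op22 f Z ≫ V ◁ W ◁ g = X ◁ Y ◁ g ≫ op22 f Z' := by
  simp only [op22, Category.assoc]
  rw [associator_inv_naturality_right_assoc, whisker_exchange_assoc]
  simp

@[simp] theorem op01_nat_assoc (f : 𝟙_ C ⟶ X) (g : Z ⟶ Z') (k : X ⊗ Z' ⟶ T) :
    op01 f Z ≫ X ◁ g ≫ k = g ≫ op01 f Z' ≫ k := by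
  rw [← Category.assoc, op01_nat, Category.assoc]

@[simp] theorem op11_nat_assoc (f : X ⟶ Y) (g : Z ⟶ Z') (k : Y ⊗ Z' ⟶ T) :
    op11 f Z ≫ Y ◁ g ≫ k = X ◁ g ≫ op11 f Z' ≫ k := by
  rw [← Category.assoc, op11_nat, Category.assoc]

@[simp] theorem op12_nat_assoc (f : X ⟶ Y ⊗ W) (g : Z ⟶ Z') (k : Y ⊗ W ⊗ Z' ⟶ T) :
    op12 f Z ≫ Y ◁ W ◁ g ≫ k = X ◁ g ≫ op12 f Z' ≫ k := by
  rw [← Category.assoc, op12_nat, Category.assoc]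

@[simp] theorem op21_nat_assoc (f : X ⊗ Y ⟶ W) (g : Z ⟶ Z') (k : W ⊗ Z' ⟶ T) :
    op21 f Z ≫ W ◁ g ≫ k = X ◁ Y ◁ g ≫ op21 f Z' ≫ k := by
  rw [← Category.assoc, op21_nat, Category.assoc]

@[simp] theorem op22_nat_assoc (f : X ⊗ Y ⟶ V ⊗ W) (g : Z ⟶ Z') (k : V ⊗ W ⊗ Z' ⟶ T) :
    op22 f Z ≫ V ◁ W ◁ g ≫ k = X ◁ Y ◁ g ≫ op22 f Z' ≫ k := by
  rw [← Category.assoc, op22_nat, Category.assoc]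

-- Needed because merged whiskers hide the pattern of `op12_nat`.
@[simp] theorem op12_nat_comp (f : X ⟶ Y ⊗ W) (g : Z ⟶ Z') (l : W ⊗ Z' ⟶ V) :
    op12 f Z ≫ Y ◁ (W ◁ g ≫ l) = X ◁ g ≫ op12 f Z' ≫ Y ◁ l := by
  rw [whiskerLeft_comp, op12_nat_assoc]

@[simp] theorem op12_nat_comp_assoc (f : X ⟶ Y ⊗ W) (g : Z ⟶ Z') (l : W ⊗ Z' ⟶ V)
    (k : Y ⊗ V ⟶ T) :
    op12 f Z ≫ Y ◁ (W ◁ g ≫ l) ≫ k = X ◁ g ≫ op12 f Z' ≫ Y ◁ l ≫ k := by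
  rw [whiskerLeft_comp, Category.assoc, op12_nat_assoc]

@[simp] theorem op22_nat_comp {U : C} (f : X ⊗ Y ⟶ V ⊗ W) (g : Z ⟶ Z') (l : W ⊗ Z' ⟶ U) :
    op22 f Z ≫ V ◁ (W ◁ g ≫ l) = X ◁ Y ◁ g ≫ op22 f Z' ≫ V ◁ l := by
  rw [whiskerLeft_comp, op22_nat_assoc]

@[simp] theorem op22_nat_comp_assoc {U : C} (f : X ⊗ Y ⟶ V ⊗ W) (g : Z ⟶ Z')
    (l : W ⊗ Z' ⟶ U) (k : V ⊗ U ⟶ T) :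
    op22 f Z ≫ V ◁ (W ◁ g ≫ l) ≫ k = X ◁ Y ◁ g ≫ op22 f Z' ≫ V ◁ l ≫ k := by
  rw [whiskerLeft_comp, Category.assoc, op22_nat_assoc]

end Strands

/-! ### Sliding operations through the braiding -/

section Braids

variable {C : Type u} [Category.{v} C] [MonoidalCategory C] [BraidedCategory C]

/-- The braiding acting on the left of `Z`. -/
abbrev br (X Y Z : C) : X ⊗ Y ⊗ Z ⟶ Y ⊗ X ⊗ Z := op22 (β_ X Y).hom Z

/-- The inverse of the braiding of `X` and `Y` acting on the left of `Z`. -/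
abbrev brInv (X Y Z : C) : Y ⊗ X ⊗ Z ⟶ X ⊗ Y ⊗ Z := op22 (β_ X Y).inv Z

theorem br_brInv (X Y Z : C) : br X Y Z ≫ brInv X Y Z = 𝟙 _ := by
  simp [br, brInv, op22]

theorem brInv_br (X Y Z : C) : brInv X Y Z ≫ br X Y Z = 𝟙 _ := by
  simp [br, brInv, op22]

variable {X Y V W Z T : C}

theorem br_op11_left (f : X ⟶ Y) (W Z : C) :
    op11 f (W ⊗ Z) ≫ br Y W Z = br X W Z ≫ W ◁ op11 f Z := by
  have h := eq_map (BraidedCategory.braiding_naturality_left f W) (fun t ↦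
    (α_ X W Z).inv ≫ t ▷ Z ≫ (α_ W Y Z).hom)
  simp only [br, op22, op11]
  convert h using 1 <;> monoidal

theorem br_op11_right (f : X ⟶ Y) (W Z : C) :
    W ◁ op11 f Z ≫ br W Y Z = br W X Z ≫ op11 f (W ⊗ Z) := by
  have h := eq_map (BraidedCategory.braiding_naturality_right W f) (fun t ↦
    (α_ W X Z).inv ≫ t ▷ Z ≫ (α_ Y W Z).hom)
  simp only [br, op22, op11]
  convert h using 1 <;> monoidal

theorem br_tensor_left (X Y W Z : C) : 
    br (X ⊗ Y) W Z = (α_ X Y (W ⊗ Z)).hom ≫ X ◁ br Y W Z ≫ br X W (Y ⊗ Z) ≫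
      W ◁ (α_ X Y Z).inv := by
  simp only [br, op22, BraidedCategory.braiding_tensor_left_hom]
  monoidal

theorem br_tensor_right (X Y W Z : C) : 
    br W (X ⊗ Y) Z = W ◁ (α_ X Y Z).hom ≫ br W X (Y ⊗ Z) ≫ X ◁ br W Y Z ≫
      (α_ X Y (W ⊗ Z)).inv := by
  simp only [br, op22, BraidedCategory.braiding_tensor_right_hom]
  monoidal

theorem br_op21_left (f : X ⊗ Y ⟶ V) (W Z : C) :
    op21 f (W ⊗ Z) ≫ br V W Z = X ◁ br Y W Z ≫ br X W (Y ⊗ Z) ≫ W ◁ op21 f Z := by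
  have h := br_op11_left f W Z
  rw [br_tensor_left] at h
  simp only [op21, op11, whiskerLeft_comp, Category.assoc] at h ⊢
  rw [h]
  simp

theorem br_op21_right (f : X ⊗ Y ⟶ V) (W Z : C) :
    W ◁ op21 f Z ≫ br W V Z = br W X (Y ⊗ Z) ≫ X ◁ br W Y Z ≫ op21 f (W ⊗ Z) := by
  have h := br_op11_right f W Z
  rw [br_tensor_right] at h
  simp only [op21, op11, whiskerLeft_comp, Category.assoc] at h ⊢
  rw [h]
  simp

theorem br_op12_left (f : V ⟶ X ⊗ Y) (W Z : C) :
    op12 f (W ⊗ Z) ≫ X ◁ br Y W Z ≫ br X W (Y ⊗ Z) = br V W Z ≫ W ◁ op12 f Z := by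
  have h := eq_map (br_op11_left f W Z) (fun t ↦ t ≫ W ◁ (α_ X Y Z).hom)
  rw [br_tensor_left] at h
  simpa [op12, op11] using h

theorem br_op12_right (f : V ⟶ X ⊗ Y) (W Z : C) :
    W ◁ op12 f Z ≫ br W X (Y ⊗ Z) ≫ X ◁ br W Y Z = br W V Z ≫ op12 f (W ⊗ Z) := by
  have h := eq_map (br_op11_right f W Z) (fun t ↦ t ≫ (α_ X Y (W ⊗ Z)).hom)
  rw [br_tensor_right] at h
  simpa [op12, op11] using h

theorem br_op22_left {V' : C} (f : X ⊗ Y ⟶ V ⊗ V') (W Z : C) :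
    op22 f (W ⊗ Z) ≫ V ◁ br V' W Z ≫ br V W (V' ⊗ Z) =
      X ◁ br Y W Z ≫ br X W (Y ⊗ Z) ≫ W ◁ op22 f Z := by
  have h := eq_map (br_op11_left f W Z) (fun t ↦ (α_ X Y (W ⊗ Z)).inv ≫ t ≫ W ◁ (α_ V V' Z).hom)
  rw [br_tensor_left, br_tensor_left] at h
  simpa [op22, op11] using h

theorem br_op10_left (f : X ⟶ 𝟙_ C) (W Z : C) :
    br X W Z ≫ W ◁ op10 f Z = op10 f (W ⊗ Z) := by
  have h := br_op11_left f W Z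
  simp only [br, op22, op10, op11, braiding_tensorUnit_left, comp_whiskerRight,
    Category.assoc] at h ⊢
  rw [whiskerLeft_comp, ← reassoc_of% h]
  monoidal

theorem br_op01_left (f : 𝟙_ C ⟶ X) (W Z : C) :
    op01 f (W ⊗ Z) ≫ br X W Z = W ◁ op01 f Z := by
  have h := br_op11_left f W Z
  simp only [br, op22, op01, op11, braiding_tensorUnit_left, comp_whiskerRight,
    Category.assoc] at h ⊢
  rw [h]
  monoidal

/-- A pairing may be slid over a strand. -/
theorem br_op20 (f : X ⊗ Y ⟶ V) (g : V ⟶ 𝟙_ C) (W Z : C) :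
    X ◁ br Y W Z ≫ br X W (Y ⊗ Z) ≫ W ◁ op21 f Z ≫ W ◁ op10 g Z =
      op21 f (W ⊗ Z) ≫ op10 g (W ⊗ Z) := by
  rw [← reassoc_of% br_op21_left f W Z, br_op10_left]

/-- A copairing may be slid over a strand. -/
theorem br_op02 (f : V ⟶ X ⊗ Y) (g : 𝟙_ C ⟶ V) (W Z : C) :
    op01 g (W ⊗ Z) ≫ op12 f (W ⊗ Z) ≫ X ◁ br Y W Z ≫ br X W (Y ⊗ Z) =
      W ◁ op01 g Z ≫ W ◁ op12 f Z := by
  rw [br_op12_left, ← Category.assoc, br_op01_left]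

end Braids

section Merge

variable {C : Type u} [Category.{v} C] [MonoidalCategory C] {X Y Z W T : C}

attribute [-simp] MonoidalCategory.whiskerLeft_comp

-- Whiskers are collected rather than expanded, so `whiskerLeft_comp` has to leave the simp set.
@[simp] theorem whiskerLeft_merge (f : Y ⟶ Z) (g : Z ⟶ W) : X ◁ f ≫ X ◁ g = X ◁ (f ≫ g) :=
  (whiskerLeft_comp X f g).symm

@[simp] theorem whiskerLeft_merge_assoc (f : Y ⟶ Z) (g : Z ⟶ W) (k : X ⊗ W ⟶ T) :
    X ◁ f ≫ X ◁ g ≫ k = X ◁ (f ≫ g) ≫ k := by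
  rw [whiskerLeft_comp, Category.assoc]

end Merge

attribute [-simp] MonoidalCategory.whiskerLeft_comp

/-! ### The axioms of a weak Hopf quasigroup, in front of a tail -/

section Quasigroup

variable {C : Type u} [Category.{v} C] [MonoidalCategory C] [BraidedCategory C]
variable (H : C) [WeakHopfQuasigroup H] (Z : C)

local notation "m" => op21 (mu H)
local notation "d" => op12 (delta H)
local notation "e" => op10 (eps H)
local notation "u" => op01 (eta H)
local notation "c" => br H H
local notation "c'" => brInv H H

theorem strand_counit_left : d Z ≫ e (H ⊗ Z) = 𝟙 _ := by
  have h := eq_map (ComonObj.counit_comul H) (fun t ↦ t ▷ Z ≫ (λ_ H).hom ▷ Z)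
  simp only [op12, op10]
  convert h using 1 <;> monoidal

theorem strand_counit_right : d Z ≫ H ◁ e Z = 𝟙 _ := by
  have h := eq_map (ComonObj.comul_counit H) (fun t ↦ t ▷ Z ≫ (ρ_ H).hom ▷ Z)
  simp only [op12, op10]
  convert h using 1 <;> monoidal

theorem strand_coassoc : d Z ≫ d (H ⊗ Z) = d Z ≫ H ◁ d Z := by
  have h := eq_map (ComonObj.comul_assoc H) (fun t ↦
    t ▷ Z ≫ (α_ H (H ⊗ H) Z).hom ≫ H ◁ (α_ H H Z).hom)
  simp only [op12]
  convert h.symm using 1 <;> monoidal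

theorem strand_one_mul : u (H ⊗ Z) ≫ m Z = 𝟙 _ := by
  have h := eq_map (UnitalMagma.one_mul (A := H)) (fun t ↦ (λ_ H).inv ▷ Z ≫ t ▷ Z)
  simp only [op01, op21]
  convert h using 1 <;> monoidal

theorem strand_mul_comul :
    m Z ≫ d Z = H ◁ d Z ≫ d (H ⊗ H ⊗ Z) ≫ H ◁ c (H ⊗ Z) ≫ m (H ⊗ H ⊗ Z) ≫ H ◁ m Z := by
  have h := eq_map (WeakHopfQuasigroup.mul_comul (H := H)) (fun t ↦
    (α_ H H Z).inv ≫ t ▷ Z ≫ (α_ H H Z).hom)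
  rw [tensorHom_def' (delta H), tensorHom_def (mu H)] at h
  simp only [tensorμ] at h
  simp only [op12, op21, op22]
  convert h using 1 <;> monoidal

theorem strand_eps_mul_assoc : m (H ⊗ Z) ≫ m Z ≫ e Z = H ◁ m Z ≫ m Z ≫ e Z := by
  have h := eq_map (WeakHopfQuasigroup.eps_mul_assoc (H := H)) (fun t ↦
    (α_ H H (H ⊗ Z)).inv ≫ (α_ (H ⊗ H) H Z).inv ≫
    t ▷ Z ≫ (λ_ Z).hom)
  simp only [op10, op21]
  convert h using 1 <;> monoidal

theorem strand_eps_mul_split_inv :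
    H ◁ m Z ≫ m Z ≫ e Z = H ◁ d (H ⊗ Z) ≫ H ◁ c' (H ⊗ Z) ≫
      m (H ⊗ H ⊗ Z) ≫ e (H ⊗ H ⊗ Z) ≫ m Z ≫ e Z := by
  rw [← strand_eps_mul_assoc]
  have h := eq_map (WeakHopfQuasigroup.eps_mul_split' (H := H)) (fun t ↦
    (α_ H H (H ⊗ Z)).inv ≫ (α_ (H ⊗ H) H Z).inv ≫
    t ▷ Z ≫ (λ_ Z).hom)
  simp only [MonoidalCategory.tensorHom_def] at h
  simp only [op10, op12, op21, op22]
  convert h using 1 <;> monoidal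

theorem strand_comul_one :
    u Z ≫ d Z ≫ H ◁ d Z = u Z ≫ d Z ≫ H ◁ H ◁ u Z ≫ H ◁ H ◁ d Z ≫ H ◁ m (H ⊗ Z) := by
  rw [← strand_coassoc]
  have h := eq_map (WeakHopfQuasigroup.delta_eta (H := H)) (fun t ↦ (λ_ Z).inv ≫ t ▷ Z ≫
    (α_ (H ⊗ H) H Z).hom ≫ (α_ H H (H ⊗ Z)).hom)
  simp only [MonoidalCategory.tensorHom_def] at h
  simp only [op01, op12, op21]
  convert h using 1 <;> monoidal

theorem strand_comul_one_inv :
    u Z ≫ d Z ≫ H ◁ d Z =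
      u Z ≫ d Z ≫ H ◁ H ◁ u Z ≫ H ◁ H ◁ d Z ≫ H ◁ c' (H ⊗ Z) ≫ H ◁ m (H ⊗ Z) := by
  rw [← strand_coassoc]
  have h := eq_map (WeakHopfQuasigroup.delta_eta' (H := H)) (fun t ↦ (λ_ Z).inv ≫ t ▷ Z ≫
    (α_ (H ⊗ H) H Z).hom ≫ (α_ H H (H ⊗ Z)).hom)
  simp only [MonoidalCategory.tensorHom_def] at h
  simp only [op01, op12, op21, op22]
  convert h using 1 <;> monoidal

theorem strand_piL :
    op11 (piL H) Z = u (H ⊗ Z) ≫ d (H ⊗ Z) ≫ H ◁ c Z ≫ m (H ⊗ Z) ≫ e (H ⊗ Z) := by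
  have h := eq_map (WeakHopfQuasigroup.target_eq (H := H)) (fun t ↦ t ▷ Z)
  simp only [op11, op01, op12, op21, op22, op10]
  refine h.trans ?_
  monoidal

theorem strand_piR :
    op11 (piR H) Z = H ◁ u Z ≫ H ◁ d Z ≫ c (H ⊗ Z) ≫ H ◁ m Z ≫ H ◁ e Z := by
  have h := eq_map (WeakHopfQuasigroup.source_eq (H := H)) (fun t ↦ t ▷ Z)
  simp only [op11, op01, op12, op21, op22, op10]
  refine h.trans ?_
  monoidal

theorem strand_conv_piL : op11 (piL H) Z = d Z ≫ H ◁ op11 (antip H) Z ≫ m Z := by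
  simp only [op11, op12, op21, piL, conv]
  monoidal

theorem strand_conv_piR : op11 (piR H) Z = d Z ≫ op11 (antip H) (H ⊗ Z) ≫ m Z := by
  simp only [op11, op12, op21, piR, conv]
  monoidal

theorem strand_antip : op11 (antip H) Z =
    d Z ≫ H ◁ op11 (piL H) Z ≫ op11 (antip H) (H ⊗ Z) ≫ m Z := by
  have h := eq_map (WeakHopfQuasigroup.antipode_target (H := H)) (fun t ↦ t ▷ Z)
  rw [conv, tensorHom_def'] at h
  simp only [op11, op12, op21, piL]
  refine h.symm.trans ?_
  monoidal

theorem strand_antip_mul : d (H ⊗ Z) ≫ H ◁ m Z ≫ op11 (antip H) (H ⊗ Z) ≫ m Z =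
    op11 (piR H) (H ⊗ Z) ≫ m Z := by
  have h := eq_map (WeakHopfQuasigroup.antipode_mul_left (H := H)) (fun t ↦ (α_ H H Z).inv ≫ t ▷ Z)
  rw [tensorHom_def'] at h
  simp only [op11, op12, op21, piR]
  convert h using 1 <;> monoidal

end Quasigroup

/-! ### Identities for the antipode, source and target morphisms -/

section Antipode

variable {C : Type u} [Category.{v} C] [MonoidalCategory C] [BraidedCategory C]
variable (H : C) [WeakHopfQuasigroup H] (Z : C)

local notation "m" => op21 (mu H)
local notation "d" => op12 (delta H)
local notation "e" => op10 (eps H)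
local notation "u" => op01 (eta H)
local notation "c" => br H H
local notation "c'" => brInv H H
local notation "pL" => op11 (piL H)
local notation "pR" => op11 (piR H)
local notation "s" => op11 (antip H)

/-- Sliding the copairing δη to the other side of the strand trades the braiding for its inverse.
This is the shape needed for the inverse-braiding form of the axiom on δη. -/
theorem strand_piL_inv :
    pL Z = H ◁ u Z ≫ H ◁ d Z ≫ c' _ ≫ m _ ≫ e _ := by
  rw [strand_piL, ← reassoc_of% br_op02 (delta H) (eta H) H Z, reassoc_of% br_brInv H H (H ⊗ Z)]

theorem comul_one_piL : u Z ≫ d Z ≫ H ◁ pL Z = u Z ≫ d Z := by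
  calc
    _ = (u Z ≫ d Z ≫ H ◁ H ◁ u Z ≫ H ◁ H ◁ d Z ≫ H ◁ c' (H ⊗ Z) ≫ H ◁ m (H ⊗ Z)) ≫
        H ◁ e _ := by rw [strand_piL_inv]; simp
    _ = u Z ≫ d Z ≫ H ◁ (d Z ≫ e _) := by rw [← strand_comul_one_inv]; simp
    _ = _ := by rw [strand_counit_left]; simp

/-- The second leg of δη is fixed by Π^L, and the axiom on δη expresses δΠ^L through a second copy
of δη whose second leg is the last output. -/
theorem piL_comul_piL : pL Z ≫ d Z ≫ H ◁ pL Z = pL Z ≫ d Z := by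
  have key : pL Z ≫ d Z =
      H ◁ (u Z ≫ d Z ≫ H ◁ H ◁ u Z ≫ H ◁ H ◁ d Z ≫ H ◁ m _) ≫ c' _ ≫ m _ ≫ e _ := by
    rw [← strand_comul_one, strand_piL_inv]; simp
  calc
    _ = (pL Z ≫ d Z) ≫ H ◁ pL Z := by simp
    _ = H ◁ (u Z ≫ d Z ≫ H ◁ H ◁ (u Z ≫ d Z ≫ H ◁ pL Z) ≫ H ◁ m _) ≫ c' _ ≫ m _ ≫ e _ := by
      rw [key]; simp
    _ = _ := by rw [comul_one_piL, key]; simp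

/-- In λ = λ ∗ Π^L, evaluated on the image of Π^L, the inner Π^L may be dropped by `piL_comul_piL`;
what remains is λ ∗ id. -/
theorem piL_antip : pL Z ≫ s Z = pL Z ≫ pR Z := by
  calc
    _ = (pL Z ≫ d Z ≫ H ◁ pL Z) ≫ s _ ≫ m _ := by rw [strand_antip]; simp
    _ = _ := by rw [piL_comul_piL, strand_conv_piR]; simp

/-- The identity ε(x(yz)) = ε(xy_2)ε(y_1z), with a further strand crossing x and y. Sliding pairings
over strands makes the inverse braiding of the axiom cancel. -/
theorem eps_mul_split_braided :
    H ◁ c _ ≫ c _ ≫ H ◁ (H ◁ m Z ≫ m Z ≫ e Z) =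
      H ◁ d _ ≫ c _ ≫ H ◁ (m _ ≫ e _) ≫ c _ ≫ H ◁ (m Z ≫ e Z) := by
  calc
    _ = H ◁ (c _ ≫ H ◁ d _) ≫ c _ ≫ H ◁ (H ◁ c' _ ≫ m _ ≫ e _ ≫ m _ ≫ e _) := by
      rw [strand_eps_mul_split_inv]; simp
    _ = H ◁ (d _ ≫ (H ◁ c _ ≫ c _ ≫ H ◁ c' _)) ≫ c _ ≫ H ◁ (m _ ≫ e _ ≫ m _ ≫ e _) := by
      rw [← br_op12_left]; simp
    _ = H ◁ d _ ≫ H ◁ c' _ ≫ H ◁ H ◁ c _ ≫ (H ◁ c _ ≫ c _ ≫ H ◁ m _ ≫ H ◁ e _) ≫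
        H ◁ (m _ ≫ e _) := by
      rw [← br_op22_left]; simp
    _ = H ◁ d _ ≫ H ◁ c' _ ≫ m _ ≫ e _ ≫ c _ ≫ H ◁ (m _ ≫ e _) := by
      rw [br_op20]; simp
    _ = H ◁ d _ ≫ H ◁ c' _ ≫ (H ◁ c _ ≫ c _ ≫ H ◁ m _ ≫ H ◁ e _) ≫ c _ ≫ H ◁ (m _ ≫ e _) := by
      rw [br_op20]; simp
    _ = H ◁ d _ ≫ H ◁ (c' _ ≫ c _) ≫ c _ ≫ H ◁ (m _ ≫ e _) ≫ c _ ≫ H ◁ (m _ ≫ e _) := by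
      simp
    _ = _ := by rw [brInv_br]; simp

/-- The identity Π^R(x)y = y_1ε(xy_2). Writing y = 1y turns the right side into 1_1y_1ε(x(1_2y_2)) =
1_1y_1ε(1_2y_2)ε(x1_3). Since δ is multiplicative, the counit absorbs the middle factor, leaving
1_1y ε(x1_2). -/
theorem piR_mul : pR (H ⊗ Z) ≫ m Z = H ◁ d Z ≫ c _ ≫ H ◁ m Z ≫ H ◁ e Z := by
  symm
  calc
    _ = H ◁ (u _ ≫ m Z ≫ d Z) ≫ c _ ≫ H ◁ m Z ≫ H ◁ e Z := by
      rw [reassoc_of% strand_one_mul H Z]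
    _ = H ◁ (u _ ≫ H ◁ d _ ≫ d _ ≫ H ◁ c _) ≫ (H ◁ m _ ≫ c _) ≫ H ◁ (H ◁ m _ ≫ m Z ≫ e Z) := by
      rw [strand_mul_comul]; simp
    _ = H ◁ (u _ ≫ H ◁ d _ ≫ d _) ≫ c _ ≫ H ◁ (H ◁ c _ ≫ c _ ≫ H ◁ (H ◁ m Z ≫ m Z ≫ e Z)) ≫
        m _ := by
      rw [br_op21_right]; simp
    _ = H ◁ (u _ ≫ H ◁ d _ ≫ (d _ ≫ H ◁ d _)) ≫ c _ ≫
        H ◁ (c _ ≫ H ◁ (m _ ≫ e _) ≫ c _ ≫ H ◁ (m Z ≫ e Z)) ≫ m _ := by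
      rw [eps_mul_split_braided]; simp
    _ = H ◁ (u _ ≫ H ◁ d _ ≫ d _) ≫ (H ◁ d _ ≫ c _ ≫ H ◁ c _) ≫
        H ◁ (H ◁ (m _ ≫ e _) ≫ c _ ≫ H ◁ (m Z ≫ e Z)) ≫ m _ := by
      rw [← strand_coassoc]; simp
    _ = H ◁ (u _ ≫ d _) ≫ c _ ≫ H ◁ (m _ ≫ e _) ≫
        (H ◁ d _ ≫ d _ ≫ H ◁ c _ ≫ m _ ≫ H ◁ m _) ≫ H ◁ e _ := by
      rw [br_op12_right]; simp
    _ = (H ◁ u _ ≫ H ◁ d _ ≫ c _ ≫ H ◁ m _ ≫ H ◁ e _) ≫ m _ ≫ d _ ≫ H ◁ e _ := by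
      rw [← strand_mul_comul]; simp
    _ = _ := by rw [strand_counit_right, ← strand_piR, Category.comp_id]

/-- By `piR_mul`, Π^R(x_1)y_1 ⊗ x_2y_2 = y_1ε(x_1y_2) ⊗ x_2y_3, and the counit of xy_2 collapses
this to y_1 ⊗ xy_2. -/
theorem piR_mul_mul :
    d _ ≫ H ◁ H ◁ d Z ≫ H ◁ c _ ≫ H ◁ H ◁ m Z ≫ pR _ ≫ m _ = H ◁ d Z ≫ c _ ≫ H ◁ m Z := by
  calc
    _ = d _ ≫ H ◁ H ◁ d Z ≫ H ◁ (c _ ≫ d _) ≫ H ◁ H ◁ H ◁ m _ ≫ c _ ≫ H ◁ m _ ≫ H ◁ e _ := by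
      rw [piR_mul]; simp
    _ = d _ ≫ H ◁ (H ◁ (d _ ≫ d _)) ≫ H ◁ c _ ≫ H ◁ H ◁ c _ ≫ H ◁ H ◁ H ◁ m _ ≫ c _ ≫
        H ◁ m _ ≫ H ◁ e _ := by
      rw [← br_op12_right]; simp
    _ = H ◁ d _ ≫ (d _ ≫ H ◁ c _ ≫ c _) ≫ H ◁ (H ◁ H ◁ d _ ≫ H ◁ c _ ≫ H ◁ H ◁ m _ ≫
        m _ ≫ e _) := by
      rw [strand_coassoc]; simp
    _ = H ◁ d _ ≫ c _ ≫ H ◁ ((H ◁ d _ ≫ d _ ≫ H ◁ c _ ≫ m _ ≫ H ◁ m _) ≫ e _) := by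
      rw [br_op12_left]; simp
    _ = _ := by rw [← strand_mul_comul, Category.assoc, strand_counit_left, Category.comp_id]

/-- The second tensor factor of `λ(x₂)₁ ⊗ x₁ λ(x₂)₂` is in the image of the target morphism. -/
theorem antip_coact_piL :
    d Z ≫ H ◁ s Z ≫ H ◁ d Z ≫ c _ ≫ H ◁ m Z ≫ H ◁ pL Z =
      d Z ≫ H ◁ s Z ≫ H ◁ d Z ≫ c _ ≫ H ◁ m Z := by
  -- With y = λ(x_2), `piR_mul_mul` inserts Π^R, which is expanded by Π^R(x)y = λ(x_1)(x_2y). The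
  -- remaining factors assemble into δ(x_2λ(x_3)), so the expression equals λ(x_1)Π^L(x_2)_1 ⊗
  -- Π^L(x_2)_2.
  have key : d Z ≫ H ◁ s Z ≫ H ◁ d Z ≫ c _ ≫ H ◁ m Z =
      d Z ≫ H ◁ (pL Z ≫ d Z) ≫ s _ ≫ m _ := by
    calc
      _ = d Z ≫ H ◁ s Z ≫ d _ ≫ H ◁ H ◁ d Z ≫ H ◁ c _ ≫ H ◁ H ◁ m Z ≫
          (d _ ≫ H ◁ m _ ≫ s _ ≫ m _) := by
        rw [strand_antip_mul, piR_mul_mul]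
      _ = (d Z ≫ d _) ≫ d _ ≫ H ◁ H ◁ H ◁ (s _ ≫ d _) ≫ H ◁ H ◁ (c _ ≫ H ◁ m _) ≫
          H ◁ m _ ≫ s _ ≫ m _ := by simp
      _ = d Z ≫ (d _ ≫ d _) ≫ H ◁ H ◁ H ◁ (s _ ≫ d _) ≫ H ◁ H ◁ (c _ ≫ H ◁ m _) ≫
          H ◁ m _ ≫ s _ ≫ m _ := by simp
      _ = (d Z ≫ d _) ≫ H ◁ (d _ ≫ H ◁ H ◁ (s _ ≫ d _) ≫ H ◁ (c _ ≫ H ◁ m _) ≫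
          m _) ≫ s _ ≫ m _ := by rw [strand_coassoc]; simp
      _ = d Z ≫ H ◁ (d _ ≫ H ◁ s _ ≫ (H ◁ d _ ≫ d _ ≫ H ◁ c _ ≫ m _ ≫ H ◁ m _)) ≫
          s _ ≫ m _ := by rw [strand_coassoc]; simp
      _ = _ := by rw [← strand_mul_comul, strand_conv_piL]; simp
  calc
    _ = (d Z ≫ H ◁ s Z ≫ H ◁ d Z ≫ c _ ≫ H ◁ m Z) ≫ H ◁ pL Z := by simp
    _ = d Z ≫ H ◁ (pL Z ≫ d Z ≫ H ◁ pL Z) ≫ s _ ≫ m _ := by rw [key]; simp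
    _ = _ := by rw [piL_comul_piL, key]

/-- The identity 1_1 ⊗ 1_2x = 1_1 ⊗ ε(1_2x_1)x_2. Writing x = 1'x on the right, associativity under
ε brings out 1_1 ⊗ 1_21'_1 ⊗ 1'_2, the iterated coproduct of 1, and a counit disappears. -/
theorem comul_one_mul :
    u (H ⊗ Z) ≫ d (H ⊗ Z) ≫ H ◁ m Z = d Z ≫ u _ ≫ d _ ≫ H ◁ m _ ≫ H ◁ e _ := by
  symm
  calc
    _ = (u _ ≫ m Z ≫ d Z) ≫ u _ ≫ d _ ≫ H ◁ m _ ≫ H ◁ e _ := by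
      rw [reassoc_of% strand_one_mul H Z]
    _ = d Z ≫ u _ ≫ d _ ≫ H ◁ c _ ≫ H ◁ H ◁ m _ ≫ u _ ≫ d _ ≫ H ◁ (H ◁ m _ ≫ m _ ≫ e _) := by
      rw [strand_mul_comul]; simp
    _ = d Z ≫ (u _ ≫ d _ ≫ H ◁ H ◁ u _ ≫ H ◁ H ◁ d _ ≫ H ◁ m _) ≫
        H ◁ (H ◁ c _ ≫ H ◁ H ◁ m _ ≫ m _ ≫ e _) := by
      rw [← strand_eps_mul_assoc]; simp
    _ = u _ ≫ d _ ≫ H ◁ ((H ◁ d _ ≫ d _ ≫ H ◁ c _ ≫ m _ ≫ H ◁ m _) ≫ e _) := by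
      rw [← strand_comul_one]; simp
    _ = _ := by
      rw [← strand_mul_comul, Category.assoc, strand_counit_left, Category.comp_id]

theorem piL_mul : pL (H ⊗ Z) ≫ m Z = pL _ ≫ H ◁ d Z ≫ m _ ≫ e _ := by
  calc
    _ = H ◁ (u _ ≫ d _ ≫ H ◁ m Z) ≫ c' _ ≫ m _ ≫ e _ := by rw [strand_piL_inv]; simp
    _ = _ := by rw [comul_one_mul, strand_piL_inv]; simp

end Antipode

/-! ### Coinvariants of a Hopf action -/

section HopfActions

variable {C : Type u} [Category.{v} C] [MonoidalCategory C] [BraidedCategory C]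

/-- A right `H`-comodule `M` with an action of `B` that satisfies the axioms of a strong Hopf
module except for the associativity with respect to the coinvariants of `B`. -/
structure IsHopfAction {H : C} [WeakHopfQuasigroup H] {B : C} [UnitalMagma B]
    (ρB : B ⟶ B ⊗ H) (h : H ⟶ B) (M : C) (φ : M ⊗ B ⟶ M) (ρ : M ⟶ M ⊗ H) : Prop where
  comodule : IsComodule H M ρ
  act_one : M ◁ eta B ≫ φ = (ρ_ M).hom
  coact_act : φ ≫ ρ = (ρ ⊗ₘ ρB) ≫ tensorμ M H B H ≫ (φ ⊗ₘ mu H)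
  act_antipode :
    M ◁ delta H ≫ (α_ M H H).inv ≫ ((M ◁ h ≫ φ) ⊗ₘ (antip H ≫ h)) ≫ φ =
      M ◁ (piL H ≫ h) ≫ φ
  antipode_act :
    M ◁ delta H ≫ (α_ M H H).inv ≫ ((M ◁ (antip H ≫ h) ≫ φ) ⊗ₘ h) ≫ φ =
      M ◁ (piR H ≫ h) ≫ φ

variable {H : C} [WeakHopfQuasigroup H] {B : C} [UnitalMagma B] {ρB : B ⟶ B ⊗ H} {h : H ⟶ B}

/-- Lets every result on `M` be applied to `B` itself, with no associativity assumption. -/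
theorem IsHopfAction.regular (hB : IsComoduleMagma H B ρB) (hh : IsAnchor ρB h) :
    IsHopfAction ρB h B (mu B) ρB where
  comodule := hB.comodule
  act_one := UnitalMagma.mul_one
  coact_act := hB.mul_coact.symm
  act_antipode := hh.mul_antipode
  antipode_act := hh.antipode_mul

theorem IsStrongHopfModule.isHopfAction {sB : Splitting (coinvEnd h (mu B) ρB)} {M : C}
    {φ : M ⊗ B ⟶ M} {ρ : M ⟶ M ⊗ H} (hM : IsStrongHopfModule sB M φ ρ) :
    IsHopfAction ρB h M φ ρ where
  comodule := hM.comodule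
  act_one := hM.act_one
  coact_act := hM.coact_act
  act_antipode := hM.act_antipode
  antipode_act := hM.antipode_act

local notation "m" => op21 (mu H)
local notation "d" => op12 (delta H)
local notation "e" => op10 (eps H)
local notation "u" => op01 (eta H)
local notation "c" => br H H
local notation "pL" => op11 (piL H)
local notation "pR" => op11 (piR H)
local notation "s" => op11 (antip H)
local notation "rB" => op12 ρB
local notation "hh" => op11 h

variable {M : C} {φ : M ⊗ B ⟶ M} {ρ : M ⟶ M ⊗ H}

local notation "a" => op21 φ
local notation "r" => op12 ρ
local notation "q" => op11 (coinvEnd h φ ρ)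

theorem IsComodule.strand_counit {X : C} {ρ : X ⟶ X ⊗ H} (hX : IsComodule H X ρ) (Z : C) :
    op12 ρ Z ≫ X ◁ e Z = 𝟙 _ := by
  have h := eq_map hX.counit (fun t ↦ t ▷ Z ≫ (ρ_ X).hom ▷ Z)
  simp only [op12, op10]
  convert h using 1 <;> monoidal

theorem IsComodule.strand_coassoc {X : C} {ρ : X ⟶ X ⊗ H} (hX : IsComodule H X ρ) (Z : C) :
    op12 ρ Z ≫ op12 ρ (H ⊗ Z) = op12 ρ Z ≫ X ◁ d Z := by
  have h := eq_map hX.coassoc (fun t ↦ t ▷ Z ≫ (α_ X (H ⊗ H) Z).hom ≫ X ◁ (α_ H H Z).hom)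
  simp only [op12]
  convert h using 1 <;> monoidal

theorem IsAnchor.strand_total (ha : IsAnchor ρB h) (Z : C) : op01 (eta B) Z = u Z ≫ op11 h Z := by
  simp only [op01, op11, ← ha.total]
  monoidal

theorem IsAnchor.strand_integral (ha : IsAnchor ρB h) (Z : C) :
    op11 h Z ≫ rB Z = d Z ≫ op11 h (H ⊗ Z) := by
  have h := eq_map ha.integral (fun t ↦ t ▷ Z ≫ (α_ B H Z).hom)
  simp only [op11, op12]
  convert h.symm using 1 <;> monoidal

omit [UnitalMagma B] in
theorem strand_coinvEnd (Z : C) : q Z = r Z ≫ M ◁ (s Z ≫ hh Z) ≫ a Z := by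
  simp only [op11, op12, op21, coinvEnd]
  monoidal

namespace IsHopfAction

variable (hM : IsHopfAction ρB h M φ ρ)
include hM

theorem strand_act_one (Z : C) : M ◁ op01 (eta B) Z ≫ a Z = 𝟙 _ := by
  have h := eq_map hM.act_one (fun t ↦ (ρ_ M).inv ▷ Z ≫ t ▷ Z)
  simp only [op01, op21]
  convert h using 1 <;> monoidal

theorem strand_coact_act (Z : C) :
    a Z ≫ r Z = M ◁ rB Z ≫ r (B ⊗ H ⊗ Z) ≫ M ◁ br H B (H ⊗ Z) ≫ a (H ⊗ H ⊗ Z) ≫ M ◁ m Z := by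
  have h := eq_map hM.coact_act (fun t ↦ (α_ M B Z).inv ≫ t ▷ Z ≫ (α_ M H Z).hom)
  rw [tensorHom_def' ρ, tensorHom_def φ] at h
  simp only [tensorμ] at h
  simp only [op12, op21, op22]
  convert h using 1 <;> monoidal

theorem strand_act_antipode (Z : C) :
    M ◁ d Z ≫ M ◁ hh (H ⊗ Z) ≫ a (H ⊗ Z) ≫ M ◁ (s Z ≫ hh Z) ≫ a Z =
      M ◁ (pL Z ≫ hh Z) ≫ a Z := by
  have h := eq_map hM.act_antipode (fun t ↦ (α_ M H Z).inv ≫ t ▷ Z)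
  rw [MonoidalCategory.tensorHom_def] at h
  simp only [op11, op12, op21]
  convert h using 1 <;> monoidal

theorem strand_antipode_act (Z : C) :
    M ◁ d Z ≫ M ◁ (s (H ⊗ Z) ≫ hh (H ⊗ Z)) ≫ a (H ⊗ Z) ≫ M ◁ hh Z ≫ a Z =
      M ◁ (pR Z ≫ hh Z) ≫ a Z := by
  have h := eq_map hM.antipode_act (fun t ↦ (α_ M H Z).inv ≫ t ▷ Z)
  rw [MonoidalCategory.tensorHom_def] at h
  simp only [op11, op12, op21]
  convert h using 1 <;> monoidal

/-- Apply the counit to the coaction of m = m·1: as 1 = h(1) and h is colinear, m =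
m_0·h(1_1)ε(m_11_2), which is m_0·hΠ^R(m_1). -/
theorem coact_piR_act (ha : IsAnchor ρB h) (Z : C) : r Z ≫ M ◁ (pR Z ≫ hh Z) ≫ a Z = 𝟙 _ := by
  symm
  calc
    _ = (M ◁ op01 (eta B) Z ≫ a Z) ≫ (r _ ≫ M ◁ e _) := by
      rw [hM.strand_act_one, hM.comodule.strand_counit, Category.comp_id]
    _ = M ◁ (u _ ≫ (hh _ ≫ rB _)) ≫ r _ ≫ M ◁ br H B _ ≫ a _ ≫ M ◁ (m _ ≫ e _) := by
      rw [Category.assoc, reassoc_of% hM.strand_coact_act, ha.strand_total]; simp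
    _ = M ◁ (u _ ≫ d _) ≫ r _ ≫ M ◁ (H ◁ hh _ ≫ br H B _) ≫ a _ ≫ M ◁ (m _ ≫ e _) := by
      rw [ha.strand_integral]; simp
    _ = r _ ≫ M ◁ ((H ◁ u _ ≫ H ◁ d _ ≫ c _ ≫ H ◁ m _ ≫ H ◁ e _) ≫ hh _) ≫ a _ := by
      rw [br_op11_right]; simp
    _ = _ := by rw [← strand_piR]

theorem coinvEnd_coact_piL (ha : IsAnchor ρB h) (Z : C) :
    q Z ≫ r Z ≫ M ◁ pL Z = q Z ≫ r Z := by
  have key : q Z ≫ r Z = r _ ≫ M ◁ (d Z ≫ H ◁ s Z ≫ H ◁ d Z ≫ c _ ≫ H ◁ m Z) ≫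
      M ◁ hh _ ≫ a _ := by
    calc
      _ = r _ ≫ M ◁ (s _ ≫ (hh _ ≫ rB _)) ≫ r _ ≫ M ◁ br H B _ ≫ a _ ≫ M ◁ m _ := by
        rw [strand_coinvEnd, Category.assoc, Category.assoc, hM.strand_coact_act]; simp
      _ = (r _ ≫ r _) ≫ M ◁ (H ◁ (s _ ≫ d _) ≫ (H ◁ hh _ ≫ br H B _)) ≫ a _ ≫ M ◁ m _ := by
        rw [ha.strand_integral]; simp
      _ = _ := by rw [br_op11_right, hM.comodule.strand_coassoc]; simp
  calc
    _ = (q Z ≫ r Z) ≫ M ◁ pL Z := by simp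
    _ = r _ ≫ M ◁ (d Z ≫ H ◁ s Z ≫ H ◁ d Z ≫ c _ ≫ H ◁ m Z ≫ H ◁ pL Z) ≫
      M ◁ hh _ ≫ a _ := by rw [key]; simp
    _ = _ := by rw [antip_coact_piL, key]

/-- On such m, m_0·hλ(m_1) = m_0·hλΠ^L(m_1) = m_0·hΠ^RΠ^L(m_1) = m_0·hΠ^R(m_1) = m. The morphism `k`
plays the role of a generalized element. -/
theorem comp_coinvEnd (ha : IsAnchor ρB h) {X Z : C} {k : X ⟶ M ⊗ Z}
    (hk : k ≫ r Z ≫ M ◁ pL Z = k ≫ r Z) : k ≫ q Z = k := by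
  calc
    _ = (k ≫ r Z ≫ M ◁ pL Z) ≫ M ◁ (s Z ≫ hh Z) ≫ a Z := by rw [hk, strand_coinvEnd]; simp
    _ = k ≫ r Z ≫ M ◁ ((pL Z ≫ s Z) ≫ hh Z) ≫ a Z := by simp
    _ = (k ≫ r Z ≫ M ◁ pL Z) ≫ M ◁ (pR Z ≫ hh Z) ≫ a Z := by rw [piL_antip]; simp
    _ = k ≫ r Z ≫ M ◁ (pR Z ≫ hh Z) ≫ a Z := by rw [hk]; simp
    _ = _ := by rw [hM.coact_piR_act ha, Category.comp_id]

theorem coinvEnd_idem (ha : IsAnchor ρB h) :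
    coinvEnd h φ ρ ≫ coinvEnd h φ ρ = coinvEnd h φ ρ := by
  -- Tensoring with the unit object is faithful, so the strand identity with tail `𝟙_ C` gives the
  -- plain one.
  rw [← whiskerRight_iff, comp_whiskerRight]
  exact hM.comp_coinvEnd ha (hM.coinvEnd_coact_piL ha (𝟙_ C))

theorem nonempty_splitting [IsIdempotentComplete C] (ha : IsAnchor ρB h) :
    Nonempty (Splitting (coinvEnd h φ ρ)) := by
  obtain ⟨Y, i, p, hip, hpi⟩ :=
    IsIdempotentComplete.idempotents_split M _ (hM.coinvEnd_idem ha)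
  exact ⟨⟨Y, i, p, hip, hpi⟩⟩

variable (sM : Splitting (coinvEnd h φ ρ))

theorem coinv_coact_piL (ha : IsAnchor ρB h) (Z : C) :
    op11 sM.i Z ≫ r Z ≫ M ◁ pL Z = op11 sM.i Z ≫ r Z := by
  have hi : op11 sM.i Z = op11 sM.i Z ≫ q Z := by
    simp only [op11, ← comp_whiskerRight, ← sM.p_i, reassoc_of% sM.i_p]
  rw [hi, Category.assoc, Category.assoc, hM.coinvEnd_coact_piL ha]

/-- On coinvariants, the coaction of a product is computed in the second factor. -/
theorem coinv_act_coact (ha : IsAnchor ρB h) (hB : IsComodule H B ρB) (Z : C) :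
    op11 sM.i (B ⊗ Z) ≫ a Z ≫ r Z = sM.obj ◁ rB Z ≫ op11 sM.i (B ⊗ H ⊗ Z) ≫ a (H ⊗ Z) := by
  -- Since m_1 may be replaced by Π^L(m_1), `piL_mul` turns Π^L(m_1)b_1 into ε(Π^L(m_1)b_1)b_2. Then
  -- Π^L is dropped again, and the counit of ρ(m·b_0) leaves m·b_0 ⊗ b_1.
  calc
    _ = sM.obj ◁ rB Z ≫ (op11 sM.i _ ≫ r _) ≫ M ◁ br H B _ ≫ a _ ≫ M ◁ m _ := by
      rw [hM.strand_coact_act]; simp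
    _ = sM.obj ◁ rB Z ≫ op11 sM.i _ ≫ r _ ≫ M ◁ (pL _ ≫ br H B _) ≫ a _ ≫ M ◁ m _ := by
      rw [← hM.coinv_coact_piL sM ha]; simp
    _ = sM.obj ◁ rB Z ≫ op11 sM.i _ ≫ r _ ≫ M ◁ br H B _ ≫ a _ ≫ M ◁ (pL _ ≫ m _) := by
      rw [br_op11_left]; simp
    _ = sM.obj ◁ rB Z ≫ op11 sM.i _ ≫ r _ ≫ M ◁ (br H B _ ≫ B ◁ pL _) ≫ a _ ≫
        M ◁ (H ◁ d _ ≫ m _ ≫ e _) := by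
      rw [piL_mul]; simp
    _ = sM.obj ◁ (rB Z ≫ B ◁ d _) ≫ (op11 sM.i _ ≫ r _ ≫ M ◁ pL _) ≫ M ◁ br H B _ ≫ a _ ≫
        M ◁ (m _ ≫ e _) := by
      rw [← br_op11_left]; simp
    _ = sM.obj ◁ (rB Z ≫ rB _) ≫ op11 sM.i _ ≫ r _ ≫ M ◁ br H B _ ≫ a _ ≫
        M ◁ (m _ ≫ e _) := by
      rw [hM.coinv_coact_piL sM ha, hB.strand_coassoc]; simp
    _ = sM.obj ◁ rB Z ≫ op11 sM.i _ ≫ (M ◁ rB _ ≫ r _ ≫ M ◁ br H B _ ≫ a _ ≫ M ◁ m _) ≫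
        M ◁ e _ := by simp
    _ = _ := by
      rw [← hM.strand_coact_act, Category.assoc, hM.comodule.strand_counit, Category.comp_id]

theorem coact_coinvEnd_act (ha : IsAnchor ρB h) (Z : C) :
    r Z ≫ q (H ⊗ Z) ≫ M ◁ hh Z ≫ a Z = 𝟙 _ := by
  calc
    _ = (r Z ≫ r _) ≫ M ◁ (s _ ≫ hh _) ≫ a _ ≫ M ◁ hh Z ≫ a Z := by rw [strand_coinvEnd]; simp
    _ = r Z ≫ (M ◁ d Z ≫ M ◁ (s _ ≫ hh _) ≫ a _ ≫ M ◁ hh Z ≫ a Z) := by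
      rw [hM.comodule.strand_coassoc, Category.assoc]
    _ = _ := by rw [hM.strand_antipode_act, hM.coact_piR_act ha]

/-- By `act_antipode` the left side is (q(m_0)·h(m_1))·hλ(m_2), and q(m_0)·h(m_1) = m. -/
theorem coact_coinvEnd_piL (ha : IsAnchor ρB h) (Z : C) :
    r Z ≫ q (H ⊗ Z) ≫ M ◁ (pL Z ≫ hh Z) ≫ a Z = q Z := by
  calc
    _ = (r Z ≫ M ◁ d _) ≫ q _ ≫ M ◁ hh _ ≫ a _ ≫ M ◁ (s Z ≫ hh Z) ≫ a Z := by
      rw [← hM.strand_act_antipode]; simp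
    _ = r Z ≫ (r _ ≫ q _ ≫ M ◁ hh _ ≫ a _) ≫ M ◁ (s Z ≫ hh Z) ≫ a Z := by
      rw [← hM.comodule.strand_coassoc]; simp
    _ = _ := by rw [hM.coact_coinvEnd_act ha, Category.id_comp, strand_coinvEnd]

end IsHopfAction

end HopfActions

section Splittings

variable {C : Type u} [Category.{v} C] [MonoidalCategory C]

theorem Splitting.strand_p_i {X : C} {f : X ⟶ X} (t : Splitting f) (Z : C) :
    op11 t.p Z ≫ op11 t.i Z = op11 f Z := by
  simp only [op11, ← comp_whiskerRight, t.p_i]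

theorem Splitting.strand_i_p {X : C} {f : X ⟶ X} (t : Splitting f) (Z : C) :
    op11 t.i Z ≫ op11 t.p Z = 𝟙 _ := by
  simp only [op11, ← comp_whiskerRight, t.i_p, id_whiskerRight]

theorem Splitting.strand_comp_p {X : C} {f : X ⟶ X} (t : Splitting f) (Z : C) :
    op11 f Z ≫ op11 t.p Z = op11 t.p Z := by
  rw [← t.strand_p_i, Category.assoc, t.strand_i_p, Category.comp_id]

end Splittings

section Associativity

variable {C : Type u} [Category.{v} C] [MonoidalCategory C] {B : C} [UnitalMagma B]

theorem strand_act_act {N Y : C} {φ : N ⊗ B ⟶ N} {j : Y ⟶ B}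
    (hact : (N ◁ j ≫ φ) ▷ B ≫ φ = (α_ N Y B).hom ≫ N ◁ (j ▷ B ≫ mu B) ≫ φ) (Z : C) :
    N ◁ op11 j (B ⊗ Z) ≫ op21 φ (B ⊗ Z) ≫ op21 φ Z =
      N ◁ (op11 j (B ⊗ Z) ≫ op21 (mu B) Z) ≫ op21 φ Z := by
  have h := eq_map hact (fun t ↦ (α_ N Y (B ⊗ Z)).inv ≫ (α_ (N ⊗ Y) B Z).inv ≫ t ▷ Z)
  simp only [op11, op21]
  convert h using 1 <;> monoidal

theorem strand_mul_mul {Y : C} {j : Y ⟶ B}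
    (hj : (j ⊗ₘ mu B) ≫ mu B = (α_ Y B B).inv ≫ (j ▷ B ≫ mu B) ▷ B ≫ mu B) (Z : C) :
    Y ◁ op21 (mu B) Z ≫ op11 j (B ⊗ Z) ≫ op21 (mu B) Z =
      op11 j (B ⊗ B ⊗ Z) ≫ op21 (mu B) (B ⊗ Z) ≫ op21 (mu B) Z := by
  have h := eq_map hj (fun t ↦ Y ◁ (α_ B B Z).inv ≫ (α_ Y (B ⊗ B) Z).inv ≫ t ▷ Z)
  rw [tensorHom_def'] at h
  simp only [op11, op21]
  convert h using 1 <;> monoidal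

end Associativity

/-! ### Products of coinvariants with elements of the magma -/

section Coinvariants

variable {C : Type u} [Category.{v} C] [MonoidalCategory C] [BraidedCategory C]
variable {H : C} [WeakHopfQuasigroup H] {B : C} [UnitalMagma B] {ρB : B ⟶ B ⊗ H} {h : H ⟶ B}
variable {M : C} {φ : M ⊗ B ⟶ M} {ρ : M ⟶ M ⊗ H}

local notation "d" => op12 (delta H)
local notation "pL" => op11 (piL H)
local notation "s" => op11 (antip H)
local notation "rB" => op12 ρB
local notation "mB" => op21 (mu B)
local notation "hh" => op11 h
local notation "qB" => op11 (coinvEnd h (mu B) ρB)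
local notation "a" => op21 φ
local notation "r" => op12 ρ
local notation "q" => op11 (coinvEnd h φ ρ)

section Action

variable (sB : Splitting (coinvEnd h (mu B) ρB)) (sM : Splitting (coinvEnd h φ ρ))

theorem strand_coinvAct (Z : C) : op21 (coinvAct sB sM) Z =
    sM.obj ◁ op11 sB.i Z ≫ op11 sM.i (B ⊗ Z) ≫ a Z ≫ op11 sM.p Z := by
  rw [coinvAct, tensorHom_def']
  simp only [op11, op21]
  monoidal

variable (hB : IsComoduleMagma H B ρB) (ha : IsAnchor ρB h) (hM : IsHopfAction ρB h M φ ρ)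
include hB ha hM

/-- For coinvariant m and x, ρ(m·x) = m·x_0 ⊗ x_1 and x_1 is fixed by Π^L, so m·x is coinvariant. -/
theorem strand_coinvAct_i (Z : C) : op21 (coinvAct sB sM) Z ≫ op11 sM.i Z =
    sM.obj ◁ op11 sB.i Z ≫ op11 sM.i (B ⊗ Z) ≫ a Z := by
  rw [strand_coinvAct]
  simp only [Category.assoc, sM.strand_p_i]
  have key := hM.comp_coinvEnd ha (k := sM.obj ◁ op11 sB.i Z ≫ op11 sM.i (B ⊗ Z) ≫ a Z) ?_
  · simpa only [Category.assoc] using key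
  calc
    _ = sM.obj ◁ op11 sB.i Z ≫ (op11 sM.i (B ⊗ Z) ≫ a Z ≫ r Z) ≫ M ◁ pL Z := by simp
    _ = sM.obj ◁ (op11 sB.i Z ≫ rB _ ≫ B ◁ pL Z) ≫ op11 sM.i _ ≫ a _ := by
      rw [hM.coinv_act_coact sM ha hB.comodule]; simp
    _ = sM.obj ◁ op11 sB.i Z ≫ (op11 sM.i (B ⊗ Z) ≫ a Z ≫ r Z) := by
      rw [(IsHopfAction.regular hB ha).coinv_coact_piL sB ha,
        hM.coinv_act_coact sM ha hB.comodule]; simp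
    _ = _ := by simp

theorem coinvAct_i : (sM.i ⊗ₘ sB.i) ≫ φ = coinvAct sB sM ≫ sM.i := by
  have h := strand_coinvAct_i sB sM hB ha hM (𝟙_ C)
  rw [← whiskerRight_iff, ← cancel_epi (α_ sM.obj sB.obj (𝟙_ C)).inv, tensorHom_def']
  simp only [op11, op21] at h
  convert h.symm using 1 <;> monoidal

variable (hact : (M ◁ sB.i ≫ φ) ▷ B ≫ φ = (α_ M sB.obj B).hom ≫ M ◁ (sB.i ▷ B ≫ mu B) ≫ φ)
include hact

/-- The coinvariant part of `φ (m ⊗ x)`, for `m` coinvariant, is `φ (m ⊗ q_B x)`. -/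
theorem coinv_act_coinvEnd (Z : C) : op11 sM.i (B ⊗ Z) ≫ a Z ≫ q Z =
    sM.obj ◁ qB Z ≫ op11 sM.i (B ⊗ Z) ≫ a Z := by
  have hBB := IsHopfAction.regular hB ha
  have assoc := strand_act_act hact
  -- The action is associative only when the middle factor is coinvariant, so b is first written as
  -- q_B(b_0)h(b_1). Then (m·b_0)·hλ(b_1) becomes ((m·q_B(b_0))·h(b_1))·hλ(b_2) =
  -- (m·q_B(b_0))·hΠ^L(b_1), and reassociating gives m·(q_B(b_0)hΠ^L(b_1)) = m·q_B(b).
  calc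
    _ = (op11 sM.i (B ⊗ Z) ≫ a Z ≫ r Z) ≫ M ◁ (s Z ≫ hh Z) ≫ a Z := by
      rw [strand_coinvEnd (φ := φ)]; simp
    _ = sM.obj ◁ (rB Z ≫ (rB _ ≫ qB _ ≫ B ◁ hh _ ≫ mB _)) ≫ op11 sM.i _ ≫ a _ ≫
        M ◁ (s Z ≫ hh Z) ≫ a Z := by
      rw [hM.coinv_act_coact sM ha hB.comodule, hBB.coact_coinvEnd_act ha]; simp
    _ = sM.obj ◁ (rB Z ≫ rB _ ≫ op11 sB.p _ ≫ sB.obj ◁ hh _) ≫ op11 sM.i _ ≫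
        (M ◁ (op11 sB.i _ ≫ mB _) ≫ a _) ≫ M ◁ (s Z ≫ hh Z) ≫ a Z := by
      rw [← sB.strand_p_i]; simp
    _ = sM.obj ◁ ((rB Z ≫ rB _) ≫ op11 sB.p _ ≫ op11 sB.i _) ≫ op11 sM.i _ ≫ a _ ≫ M ◁ hh _ ≫
        a _ ≫ M ◁ (s Z ≫ hh Z) ≫ a Z := by
      rw [← assoc]; simp
    _ = sM.obj ◁ (rB Z ≫ op11 sB.p _ ≫ op11 sB.i _) ≫ op11 sM.i _ ≫ a _ ≫
        (M ◁ d Z ≫ M ◁ hh _ ≫ a _ ≫ M ◁ (s Z ≫ hh Z) ≫ a Z) := by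
      rw [hB.comodule.strand_coassoc]; simp
    _ = sM.obj ◁ (rB Z ≫ op11 sB.p _ ≫ sB.obj ◁ (pL Z ≫ hh Z)) ≫ op11 sM.i _ ≫
        (M ◁ op11 sB.i _ ≫ a _ ≫ a _) := by
      rw [hM.strand_act_antipode]; simp
    _ = sM.obj ◁ (rB Z ≫ (op11 sB.p _ ≫ op11 sB.i _) ≫ B ◁ (pL Z ≫ hh Z) ≫ mB _) ≫
        op11 sM.i _ ≫ a _ := by
      rw [assoc]; simp
    _ = _ := by rw [sB.strand_p_i, hBB.coact_coinvEnd_piL ha]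

theorem coinv_act_p (Z : C) : op11 sM.i (B ⊗ Z) ≫ a Z ≫ op11 sM.p Z =
    sM.obj ◁ op11 sB.p Z ≫ op21 (coinvAct sB sM) Z := by
  calc
    _ = (op11 sM.i (B ⊗ Z) ≫ a Z ≫ q Z) ≫ op11 sM.p Z := by
      rw [Category.assoc, Category.assoc, sM.strand_comp_p]
    _ = sM.obj ◁ (op11 sB.p Z ≫ op11 sB.i Z) ≫ op11 sM.i (B ⊗ Z) ≫ a Z ≫ op11 sM.p Z := by
      rw [coinv_act_coinvEnd sB sM hB ha hM hact, sB.strand_p_i]; simp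
    _ = _ := by rw [strand_coinvAct]; simp

end Action

end Coinvariants

/-! ### The tensor product over the coinvariants -/

section Tensor

variable {C : Type u} [Category.{v} C] [MonoidalCategory C] [BraidedCategory C]
variable {H : C} [WeakHopfQuasigroup H] {B : C} [UnitalMagma B] {ρB : B ⟶ B ⊗ H} {h : H ⟶ B}
variable {M : C} {φ : M ⊗ B ⟶ M} {ρ : M ⟶ M ⊗ H}
variable (sB : Splitting (coinvEnd h (mu B) ρB)) (sM : Splitting (coinvEnd h φ ρ))
variable [HasCoequalizers C]

local notation "m" => op21 (mu H)
local notation "d" => op12 (delta H)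
local notation "pL" => op11 (piL H)
local notation "pR" => op11 (piR H)
local notation "s" => op11 (antip H)
local notation "rB" => op12 ρB
local notation "mB" => op21 (mu B)
local notation "hh" => op11 h
local notation "a" => op21 φ
local notation "r" => op12 ρ
local notation "n" => op21 (coinvProj sB sM)
local notation "k" => op21 (coinvAct sB sM)

instance : Epi (coinvProj sB sM) := coequalizer.π_epi

theorem epi_strand_id : Epi (n (𝟙_ C)) := by
  have : Epi (coinvProj sB sM ▷ (𝟙_ C)) := by rw [whiskerRight_id]; infer_instance
  unfold op21; infer_instance

theorem epi_strand_of_preserves (X : C)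
    [PreservesColimitsOfShape WalkingParallelPair (tensorRight X)] :
    Epi (n (X ⊗ 𝟙_ C)) := by
  have : Epi (coinvProj sB sM ▷ X) :=
    inferInstanceAs (Epi ((tensorRight X).map (coequalizer.π (tensorFst sB sM) (tensorSnd sB sM))))
  have : Epi (coinvProj sB sM ▷ (X ⊗ 𝟙_ C)) := by
    rw [whiskerRight_tensor, whiskerRight_id]; infer_instance
  unfold op21; infer_instance

/-- Preservation is assumed only for B and H; the coinvariants of B are a retract of B, so the
epimorphism property passes to them. -/
theorem epi_strand_coinv [PreservesColimitsOfShape WalkingParallelPair (tensorRight B)] :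
    Epi (n (sB.obj ⊗ B ⊗ 𝟙_ C)) := by
  have : Epi (coinvProj sB sM ▷ B ▷ B) :=
    inferInstanceAs (Epi ((tensorRight B ⋙ tensorRight B).map
      (coequalizer.π (tensorFst sB sM) (tensorSnd sB sM))))
  have : Epi (coinvProj sB sM ▷ (B ⊗ B ⊗ 𝟙_ C)) := by
    rw [whiskerRight_tensor, whiskerRight_tensor, whiskerRight_id]; infer_instance
  have : Epi (n (B ⊗ B ⊗ 𝟙_ C)) := by unfold op21; infer_instance
  refine ⟨fun f g hfg ↦ ?_⟩
  have key : coinvTensor sB sM ◁ op11 sB.p _ ≫ f = coinvTensor sB sM ◁ op11 sB.p _ ≫ g := by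
    rw [← cancel_epi (n (B ⊗ B ⊗ 𝟙_ C)), ← Category.assoc, ← Category.assoc, op21_nat,
      Category.assoc, Category.assoc, hfg]
  have hi := congrArg (fun t ↦ coinvTensor sB sM ◁ t) (sB.strand_i_p (B ⊗ 𝟙_ C))
  simp only [MonoidalCategory.whiskerLeft_comp, MonoidalCategory.whiskerLeft_id] at hi
  rw [← Category.id_comp f, ← Category.id_comp g, ← hi, Category.assoc, Category.assoc, key]

theorem strand_coinvProj_condition (Z : C) :
    k (B ⊗ Z) ≫ n Z = sM.obj ◁ (op11 sB.i (B ⊗ Z) ≫ mB Z) ≫ n Z := by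
  have hn : tensorFst sB sM ≫ coinvProj sB sM = tensorSnd sB sM ≫ coinvProj sB sM :=
    coequalizer.condition _ _
  have h := eq_map hn (fun t ↦
    (α_ sM.obj sB.obj (B ⊗ Z)).inv ≫ (α_ (sM.obj ⊗ sB.obj) B Z).inv ≫ t ▷ Z)
  simp only [op11, op21]
  rw [tensorFst, tensorSnd] at h
  convert h using 1 <;> monoidal

section Descent

variable (hB : IsComoduleMagma H B ρB) (ha : IsAnchor ρB h)
include hB ha

theorem existsUnique_tensorMap (hM : IsHopfAction ρB h M φ ρ)
    (hact : (M ◁ sB.i ≫ φ) ▷ B ≫ φ = (α_ M sB.obj B).hom ≫ M ◁ (sB.i ▷ B ≫ mu B) ≫ φ) :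
    ∃! ω : coinvTensor sB sM ⟶ M, coinvProj sB sM ≫ ω = sM.i ▷ B ≫ φ := by
  refine Cofork.IsColimit.existsUnique (coequalizerIsCoequalizer _ _) _ ?_
  have key : ∀ Z : C, k (B ⊗ Z) ≫ op11 sM.i _ ≫ a Z =
      sM.obj ◁ (op11 sB.i _ ≫ mB Z) ≫ op11 sM.i _ ≫ a Z := fun Z ↦ by
    calc
      _ = op11 sM.i _ ≫ M ◁ op11 sB.i _ ≫ a _ ≫ a Z := by
        rw [← Category.assoc, strand_coinvAct_i sB sM hB ha hM]; simp
      _ = _ := by rw [strand_act_act hact]; simp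
  have h := key (𝟙_ C)
  rw [← whiskerRight_iff, ← cancel_epi (α_ (sM.obj ⊗ sB.obj) B (𝟙_ C)).inv,
    ← cancel_epi (α_ sM.obj sB.obj (B ⊗ 𝟙_ C)).inv, tensorFst, tensorSnd]
  simp only [op11, op21] at h
  convert h using 1 <;> monoidal

/-- The coaction respects the relations because ρ(xb) = xb_0 ⊗ b_1 for x coinvariant in B. -/
theorem existsUnique_tensorCoact :
    ∃! ρT : coinvTensor sB sM ⟶ coinvTensor sB sM ⊗ H, coinvProj sB sM ≫ ρT =
      sM.obj ◁ ρB ≫ (α_ sM.obj B H).inv ≫ coinvProj sB sM ▷ H := by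
  refine Cofork.IsColimit.existsUnique (coequalizerIsCoequalizer _ _) _ ?_
  have key : ∀ Z : C, k (B ⊗ Z) ≫ sM.obj ◁ rB Z ≫ n (H ⊗ Z) =
      sM.obj ◁ (op11 sB.i _ ≫ mB Z) ≫ sM.obj ◁ rB Z ≫ n (H ⊗ Z) := fun Z ↦ by
    calc
      _ = sM.obj ◁ sB.obj ◁ rB Z ≫ k _ ≫ n _ := by simp
      _ = sM.obj ◁ (sB.obj ◁ rB Z ≫ op11 sB.i _ ≫ mB _) ≫ n _ := by
        rw [strand_coinvProj_condition]; simp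
      _ = _ := by
        rw [← (IsHopfAction.regular hB ha).coinv_act_coact sB ha hB.comodule]; simp
  have h := key (𝟙_ C)
  rw [← whiskerRight_iff, ← cancel_epi (α_ (sM.obj ⊗ sB.obj) B (𝟙_ C)).inv,
    ← cancel_epi (α_ sM.obj sB.obj (B ⊗ 𝟙_ C)).inv,
    ← cancel_mono (α_ (coinvTensor sB sM) H (𝟙_ C)).hom, tensorFst, tensorSnd]
  simp only [op11, op12, op21] at h
  convert h using 1 <;> monoidal

end Descent

theorem existsUnique_tensorAct [PreservesColimitsOfShape WalkingParallelPair (tensorRight B)]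
    (hmul : (sB.i ⊗ₘ mu B) ≫ mu B = (α_ sB.obj B B).inv ≫ (sB.i ▷ B ≫ mu B) ▷ B ≫ mu B) :
    ∃! φT : coinvTensor sB sM ⊗ B ⟶ coinvTensor sB sM, coinvProj sB sM ▷ B ≫ φT =
      (α_ sM.obj B B).hom ≫ sM.obj ◁ mu B ≫ coinvProj sB sM := by
  -- The action has source T ⊗ B, which is a coequalizer only because − ⊗ B preserves the one
  -- defining T.
  refine Cofork.IsColimit.existsUnique (isColimitOfHasCoequalizerOfPreservesColimit
    (tensorRight B) (tensorFst sB sM) (tensorSnd sB sM)) _ ?_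
  have key : ∀ Z : C, k (B ⊗ B ⊗ Z) ≫ sM.obj ◁ mB Z ≫ n Z =
      sM.obj ◁ (op11 sB.i _ ≫ mB _) ≫ sM.obj ◁ mB Z ≫ n Z := fun Z ↦ by
    calc
      _ = sM.obj ◁ sB.obj ◁ mB Z ≫ k _ ≫ n _ := by simp
      _ = sM.obj ◁ (sB.obj ◁ mB Z ≫ op11 sB.i _ ≫ mB _) ≫ n _ := by
        rw [strand_coinvProj_condition]; simp
      _ = _ := by rw [strand_mul_mul hmul]; simp
  have h := key (𝟙_ C)
  change tensorFst sB sM ▷ B ≫ _ = tensorSnd sB sM ▷ B ≫ _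
  rw [← whiskerRight_iff, ← cancel_epi (α_ ((sM.obj ⊗ sB.obj) ⊗ B) B (𝟙_ C)).inv,
    ← cancel_epi (α_ (sM.obj ⊗ sB.obj) B (B ⊗ 𝟙_ C)).inv,
    ← cancel_epi (α_ sM.obj sB.obj (B ⊗ B ⊗ 𝟙_ C)).inv, tensorFst, tensorSnd]
  simp only [op11, op21] at h
  convert h using 1 <;> monoidal

section Structure

variable {φT : coinvTensor sB sM ⊗ B ⟶ coinvTensor sB sM}
  {ρT : coinvTensor sB sM ⟶ coinvTensor sB sM ⊗ H} {ω : coinvTensor sB sM ⟶ M}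

theorem strand_tensorAct (hφ : coinvProj sB sM ▷ B ≫ φT =
    (α_ sM.obj B B).hom ≫ sM.obj ◁ mu B ≫ coinvProj sB sM) (Z : C) :
    n (B ⊗ Z) ≫ op21 φT Z = sM.obj ◁ mB Z ≫ n Z := by
  have h := eq_map hφ (fun t ↦ (α_ sM.obj B (B ⊗ Z)).inv ≫ (α_ (sM.obj ⊗ B) B Z).inv ≫ t ▷ Z)
  simp only [op21]
  convert h using 1 <;> monoidal

theorem strand_tensorCoact (hρ : coinvProj sB sM ≫ ρT =
    sM.obj ◁ ρB ≫ (α_ sM.obj B H).inv ≫ coinvProj sB sM ▷ H) (Z : C) :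
    n Z ≫ op12 ρT Z = sM.obj ◁ rB Z ≫ n (H ⊗ Z) := by
  have h := eq_map hρ (fun t ↦ (α_ sM.obj B Z).inv ≫ t ▷ Z ≫ (α_ (coinvTensor sB sM) H Z).hom)
  simp only [op12, op21]
  convert h using 1 <;> monoidal

theorem strand_tensorMap (hω : coinvProj sB sM ≫ ω = sM.i ▷ B ≫ φ) (Z : C) :
    n Z ≫ op11 ω Z = op11 sM.i _ ≫ a Z := by
  have h := eq_map hω (fun t ↦ (α_ sM.obj B Z).inv ≫ t ▷ Z)
  simp only [op11, op21]
  convert h using 1 <;> monoidal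

theorem strand_tensorInv (Z : C) : op11 (ρ ≫ (sM.p ⊗ₘ h) ≫ coinvProj sB sM) Z =
    r Z ≫ op11 sM.p _ ≫ sM.obj ◁ hh Z ≫ n Z := by
  rw [MonoidalCategory.tensorHom_def]
  simp only [op11, op12, op21]
  monoidal

theorem isComodule_tensor (hB : IsComoduleMagma H B ρB) (hρ : coinvProj sB sM ≫ ρT =
    sM.obj ◁ ρB ≫ (α_ sM.obj B H).inv ≫ coinvProj sB sM ▷ H) :
    IsComodule H (coinvTensor sB sM) ρT := by
  have hr := strand_tensorCoact sB sM hρ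
  have := epi_strand_id sB sM
  constructor
  · have key : op12 ρT (𝟙_ C) ≫ coinvTensor sB sM ◁ op10 (eps H) (𝟙_ C) = 𝟙 _ := by
      rw [← cancel_epi (n (𝟙_ C)), reassoc_of% hr, op21_nat, whiskerLeft_merge_assoc,
        hB.comodule.strand_counit]
      simp
    rw [← whiskerRight_iff, ← cancel_mono ((ρ_ (coinvTensor sB sM)).hom ▷ (𝟙_ C))]
    simp only [op10, op12] at key
    convert key using 1 <;> monoidal
  · have key : op12 ρT (𝟙_ C) ≫ op12 ρT (H ⊗ 𝟙_ C) =
        op12 ρT (𝟙_ C) ≫ coinvTensor sB sM ◁ op12 (delta H) (𝟙_ C) := by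
      rw [← cancel_epi (n (𝟙_ C)), reassoc_of% hr, reassoc_of% hr, hr, op21_nat]
      simp [hB.comodule.strand_coassoc]
    rw [← whiskerRight_iff, ← cancel_mono (α_ (coinvTensor sB sM) (H ⊗ H) (𝟙_ C)).hom,
      ← cancel_mono (coinvTensor sB sM ◁ (α_ H H (𝟙_ C)).hom)]
    simp only [op12] at key
    convert key using 1 <;> monoidal

end Structure

/-! ### The Hopf module structure of the tensor product and the comparison isomorphism -/

section HopfModule

variable {φT : coinvTensor sB sM ⊗ B ⟶ coinvTensor sB sM}
  {ρT : coinvTensor sB sM ⟶ coinvTensor sB sM ⊗ H} {ω : coinvTensor sB sM ⟶ M}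

theorem isHopfAction_tensor [PreservesColimitsOfShape WalkingParallelPair (tensorRight B)]
    [PreservesColimitsOfShape WalkingParallelPair (tensorRight H)]
    (hB : IsComoduleMagma H B ρB) (ha : IsAnchor ρB h)
    (hφ : coinvProj sB sM ▷ B ≫ φT = (α_ sM.obj B B).hom ≫ sM.obj ◁ mu B ≫ coinvProj sB sM)
    (hρ : coinvProj sB sM ≫ ρT = sM.obj ◁ ρB ≫ (α_ sM.obj B H).inv ≫ coinvProj sB sM ▷ H) :
    IsHopfAction ρB h (coinvTensor sB sM) φT ρT := by
  have hBB := IsHopfAction.regular hB ha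
  have hr := strand_tensorCoact sB sM hρ
  have hf := strand_tensorAct sB sM hφ
  refine ⟨isComodule_tensor sB sM hB hρ, ?_, ?_, ?_, ?_⟩
  · have := epi_strand_id sB sM
    have key : coinvTensor sB sM ◁ op01 (eta B) (𝟙_ C) ≫ op21 φT (𝟙_ C) = 𝟙 _ := by
      rw [← cancel_epi (n (𝟙_ C)), reassoc_of% op21_nat, hf]
      simp [hBB.strand_act_one]
    rw [← whiskerRight_iff, ← cancel_epi ((ρ_ (coinvTensor sB sM)).inv ▷ (𝟙_ C))]
    simp only [op01, op21] at key
    convert key using 1 <;> monoidal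
  · have := epi_strand_of_preserves sB sM B
    have key : op21 φT (𝟙_ C) ≫ op12 ρT (𝟙_ C) =
        coinvTensor sB sM ◁ rB (𝟙_ C) ≫ op12 ρT (B ⊗ H ⊗ 𝟙_ C) ≫
          coinvTensor sB sM ◁ br H B (H ⊗ 𝟙_ C) ≫ op21 φT (H ⊗ H ⊗ 𝟙_ C) ≫
            coinvTensor sB sM ◁ m (𝟙_ C) := by
      rw [← cancel_epi (n (B ⊗ 𝟙_ C)), reassoc_of% hf, hr]
      calc
        _ = sM.obj ◁ (B ◁ rB _ ≫ rB _ ≫ B ◁ br H B _ ≫ mB _ ≫ B ◁ m _) ≫ n _ := by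
          rw [← hBB.strand_coact_act]; simp
        _ = sM.obj ◁ B ◁ rB _ ≫ (n _ ≫ op12 ρT _) ≫ coinvTensor sB sM ◁ br H B _ ≫
            op21 φT _ ≫ coinvTensor sB sM ◁ m _ := by
          rw [hr]
          simp [hf]
        _ = _ := by simp
    rw [← whiskerRight_iff, ← cancel_epi (α_ (coinvTensor sB sM) B (𝟙_ C)).inv,
      ← cancel_mono (α_ (coinvTensor sB sM) H (𝟙_ C)).hom, tensorHom_def' ρT,
      tensorHom_def φT]
    simp only [tensorμ]
    simp only [op12, op21, op22] at key
    convert key using 1 <;> monoidal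
  · have := epi_strand_of_preserves sB sM H
    have key : coinvTensor sB sM ◁ d (𝟙_ C) ≫ coinvTensor sB sM ◁ hh (H ⊗ 𝟙_ C) ≫
        op21 φT (H ⊗ 𝟙_ C) ≫ coinvTensor sB sM ◁ (s (𝟙_ C) ≫ hh (𝟙_ C)) ≫ op21 φT (𝟙_ C) =
          coinvTensor sB sM ◁ (pL (𝟙_ C) ≫ hh (𝟙_ C)) ≫ op21 φT (𝟙_ C) := by
      rw [← cancel_epi (n (H ⊗ 𝟙_ C))]
      calc
        _ = sM.obj ◁ (B ◁ d _ ≫ B ◁ hh _ ≫ mB _ ≫ B ◁ (s _ ≫ hh _) ≫ mB _) ≫ n _ := by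
          simp [reassoc_of% hf, hf]
        _ = _ := by
          rw [hBB.strand_act_antipode]
          simp [hf]
    rw [← whiskerRight_iff, ← cancel_epi (α_ (coinvTensor sB sM) H (𝟙_ C)).inv,
      MonoidalCategory.tensorHom_def]
    simp only [op11, op12, op21] at key
    convert key using 1 <;> monoidal
  · have := epi_strand_of_preserves sB sM H
    have key : coinvTensor sB sM ◁ d (𝟙_ C) ≫ coinvTensor sB sM ◁ (s (H ⊗ 𝟙_ C) ≫ hh (H ⊗ 𝟙_ C)) ≫
        op21 φT (H ⊗ 𝟙_ C) ≫ coinvTensor sB sM ◁ hh (𝟙_ C) ≫ op21 φT (𝟙_ C) =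
          coinvTensor sB sM ◁ (pR (𝟙_ C) ≫ hh (𝟙_ C)) ≫ op21 φT (𝟙_ C) := by
      rw [← cancel_epi (n (H ⊗ 𝟙_ C))]
      calc
        _ = sM.obj ◁ (B ◁ d _ ≫ B ◁ (s _ ≫ hh _) ≫ mB _ ≫ B ◁ hh _ ≫ mB _) ≫ n _ := by
          simp [reassoc_of% hf, hf]
        _ = _ := by
          rw [hBB.strand_antipode_act]
          simp [hf]
    rw [← whiskerRight_iff, ← cancel_epi (α_ (coinvTensor sB sM) H (𝟙_ C)).inv,
      MonoidalCategory.tensorHom_def]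
    simp only [op11, op12, op21] at key
    convert key using 1 <;> monoidal

theorem tensorAct_assoc [PreservesColimitsOfShape WalkingParallelPair (tensorRight B)]
    (hmul : (B ◁ sB.i ≫ mu B) ▷ B ≫ mu B =
      (α_ B sB.obj B).hom ≫ B ◁ (sB.i ▷ B ≫ mu B) ≫ mu B)
    (hφ : coinvProj sB sM ▷ B ≫ φT = (α_ sM.obj B B).hom ≫ sM.obj ◁ mu B ≫ coinvProj sB sM) :
    (coinvTensor sB sM ◁ sB.i ≫ φT) ▷ B ≫ φT =
      (α_ (coinvTensor sB sM) sB.obj B).hom ≫ coinvTensor sB sM ◁ (sB.i ▷ B ≫ mu B) ≫ φT := by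
  have hf := strand_tensorAct sB sM hφ
  have := epi_strand_coinv sB sM
  have key : coinvTensor sB sM ◁ op11 sB.i (B ⊗ 𝟙_ C) ≫ op21 φT (B ⊗ 𝟙_ C) ≫ op21 φT (𝟙_ C) =
      coinvTensor sB sM ◁ (op11 sB.i (B ⊗ 𝟙_ C) ≫ mB (𝟙_ C)) ≫ op21 φT (𝟙_ C) := by
    rw [← cancel_epi (n (sB.obj ⊗ B ⊗ 𝟙_ C))]
    calc
      -- Composed with n, both sides act in the second factor alone, where the claim is (bx)c =
      -- b(xc) for x coinvariant.
      _ = sM.obj ◁ (B ◁ op11 sB.i _ ≫ mB _ ≫ mB _) ≫ n _ := by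
        simp [reassoc_of% hf, hf]
      _ = _ := by
        rw [strand_act_act hmul]
        simp [hf]
  rw [← whiskerRight_iff, ← cancel_epi (α_ (coinvTensor sB sM ⊗ sB.obj) B (𝟙_ C)).inv,
    ← cancel_epi (α_ (coinvTensor sB sM) sB.obj (B ⊗ 𝟙_ C)).inv]
  simp only [op11, op21] at key
  convert key using 1 <;> monoidal

section Comparison

variable (ha : IsAnchor ρB h)
include ha

theorem isComoduleHom_tensorMap (hB : IsComoduleMagma H B ρB) (hM : IsHopfAction ρB h M φ ρ)
    (hρ : coinvProj sB sM ≫ ρT = sM.obj ◁ ρB ≫ (α_ sM.obj B H).inv ≫ coinvProj sB sM ▷ H)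
    (hω : coinvProj sB sM ≫ ω = sM.i ▷ B ≫ φ) : IsComoduleHom ρT ρ ω := by
  have hw := strand_tensorMap sB sM hω
  have := epi_strand_id sB sM
  have key : op12 ρT (𝟙_ C) ≫ op11 ω (H ⊗ 𝟙_ C) = op11 ω (𝟙_ C) ≫ r (𝟙_ C) := by
    rw [← cancel_epi (n (𝟙_ C)), reassoc_of% hw, reassoc_of% strand_tensorCoact sB sM hρ, hw,
      hM.coinv_act_coact sM ha hB.comodule]
  rw [IsComoduleHom, ← whiskerRight_iff, ← cancel_mono (α_ M H (𝟙_ C)).hom]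
  simp only [op11, op12] at key
  convert key using 1 <;> monoidal

theorem isComoduleHom_tensorInv (hM : IsHopfAction ρB h M φ ρ)
    (hρ : coinvProj sB sM ≫ ρT = sM.obj ◁ ρB ≫ (α_ sM.obj B H).inv ≫ coinvProj sB sM ▷ H) :
    IsComoduleHom ρ ρT (ρ ≫ (sM.p ⊗ₘ h) ≫ coinvProj sB sM) := by
  have key : r (𝟙_ C) ≫ op11 (ρ ≫ (sM.p ⊗ₘ h) ≫ coinvProj sB sM) (H ⊗ 𝟙_ C) =
      op11 (ρ ≫ (sM.p ⊗ₘ h) ≫ coinvProj sB sM) (𝟙_ C) ≫ op12 ρT (𝟙_ C) := by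
    rw [strand_tensorInv, strand_tensorInv]
    calc
      _ = (r (𝟙_ C) ≫ r _) ≫ op11 sM.p _ ≫ sM.obj ◁ hh _ ≫ n _ := by simp
      _ = r (𝟙_ C) ≫ op11 sM.p _ ≫ sM.obj ◁ (hh _ ≫ rB _) ≫ n _ := by
        rw [hM.comodule.strand_coassoc, ha.strand_integral]; simp
      _ = _ := by simp [strand_tensorCoact sB sM hρ]
  rw [IsComoduleHom, ← whiskerRight_iff, ← cancel_mono (α_ (coinvTensor sB sM) H (𝟙_ C)).hom]
  simp only [op11, op12] at key
  convert key using 1 <;> monoidal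

theorem tensorMap_comp_inv (hB : IsComoduleMagma H B ρB) (hM : IsHopfAction ρB h M φ ρ)
    (hact : (M ◁ sB.i ≫ φ) ▷ B ≫ φ = (α_ M sB.obj B).hom ≫ M ◁ (sB.i ▷ B ≫ mu B) ≫ φ)
    (hω : coinvProj sB sM ≫ ω = sM.i ▷ B ≫ φ) :
    ω ≫ ρ ≫ (sM.p ⊗ₘ h) ≫ coinvProj sB sM = 𝟙 _ := by
  have := epi_strand_id sB sM
  have key : op11 ω (𝟙_ C) ≫ op11 (ρ ≫ (sM.p ⊗ₘ h) ≫ coinvProj sB sM) (𝟙_ C) = 𝟙 _ := by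
    rw [← cancel_epi (n (𝟙_ C)), reassoc_of% strand_tensorMap sB sM hω, strand_tensorInv]
    -- The class of m ⊗ b goes to p(m·b_0) ⊗ h(b_1) = m·p_B(b_0) ⊗ h(b_1). The coequalizer relation
    -- moves p_B(b_0) across, and q_B(b_0)h(b_1) = b.
    calc
      _ = (op11 sM.i _ ≫ a (𝟙_ C) ≫ r (𝟙_ C)) ≫ op11 sM.p _ ≫ sM.obj ◁ hh _ ≫ n _ := by simp
      _ = sM.obj ◁ rB (𝟙_ C) ≫ (op11 sM.i _ ≫ a _ ≫ op11 sM.p _) ≫ sM.obj ◁ hh _ ≫ n _ := by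
        rw [hM.coinv_act_coact sM ha hB.comodule]; simp
      _ = sM.obj ◁ (rB (𝟙_ C) ≫ op11 sB.p _ ≫ sB.obj ◁ hh _) ≫ k _ ≫ n _ := by
        rw [coinv_act_p sB sM hB ha hM hact]; simp
      _ = sM.obj ◁ (rB (𝟙_ C) ≫ (op11 sB.p _ ≫ op11 sB.i _) ≫ B ◁ hh _ ≫ mB _) ≫ n _ := by
        rw [strand_coinvProj_condition]; simp
      _ = _ := by
        rw [sB.strand_p_i, (IsHopfAction.regular hB ha).coact_coinvEnd_act ha]; simp
  rw [← whiskerRight_iff, comp_whiskerRight, id_whiskerRight]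
  exact key

theorem tensorInv_comp_map (hM : IsHopfAction ρB h M φ ρ)
    (hω : coinvProj sB sM ≫ ω = sM.i ▷ B ≫ φ) :
    (ρ ≫ (sM.p ⊗ₘ h) ≫ coinvProj sB sM) ≫ ω = 𝟙 _ := by
  have key : op11 (ρ ≫ (sM.p ⊗ₘ h) ≫ coinvProj sB sM) (𝟙_ C) ≫ op11 ω (𝟙_ C) = 𝟙 _ := by
    rw [strand_tensorInv]
    calc
      _ = r _ ≫ op11 sM.p _ ≫ sM.obj ◁ hh _ ≫ n _ ≫ op11 ω _ := by simp
      _ = r _ ≫ (op11 sM.p _ ≫ op11 sM.i _) ≫ M ◁ hh _ ≫ a _ := by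
        rw [strand_tensorMap sB sM hω]; simp
      _ = _ := by rw [sM.strand_p_i, hM.coact_coinvEnd_act ha]
  rw [← whiskerRight_iff, comp_whiskerRight, id_whiskerRight]
  exact key

end Comparison

end HopfModule

end Tensor

end DoiHopf

theorem proposition2p13 {C : Type u} [Category.{v} C] [MonoidalCategory C] [BraidedCategory C]
    [IsIdempotentComplete C] [HasCoequalizers C]
    {H : C} [WeakHopfQuasigroup H] {B : C} [UnitalMagma B]
    {ρB : B ⟶ B ⊗ H} (_hB : IsComoduleMagma H B ρB)
    {h : H ⟶ B} (_hh : IsAnchor ρB h)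
    (_presB : PreservesColimitsOfShape WalkingParallelPair (tensorRight B))
    (_presH : PreservesColimitsOfShape WalkingParallelPair (tensorRight H)) :
    -- `q_B` is a split idempotent; everything holds for each choice of `B^{coH}`
    Nonempty (Splitting (coinvEnd h (mu B) ρB)) ∧
    ∀ sB : Splitting (coinvEnd h (mu B) ρB),
      (B ◁ sB.i ≫ mu B) ▷ B ≫ mu B =
        (α_ B sB.obj B).hom ≫ B ◁ (sB.i ▷ B ≫ mu B) ≫ mu B →
      (sB.i ⊗ₘ mu B) ≫ mu B =
        (α_ sB.obj B B).inv ≫ (sB.i ▷ B ≫ mu B) ▷ B ≫ mu B →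
      ∀ (M : C) (φM : M ⊗ B ⟶ M) (ρM : M ⟶ M ⊗ H), IsStrongHopfModule sB M φM ρM →
        -- `q_M` is a split idempotent; everything holds for each choice of `M^{coH}`
        Nonempty (Splitting (coinvEnd h φM ρM)) ∧
        ∀ sM : Splitting (coinvEnd h φM ρM),
          -- the action of `B` on `M` restricts to the coinvariants
          (sM.i ⊗ₘ sB.i) ≫ φM = coinvAct sB sM ≫ sM.i ∧
          -- the induced action, the induced coaction and the induced morphism exist
          (∃! φT : coinvTensor sB sM ⊗ B ⟶ coinvTensor sB sM,
            coinvProj sB sM ▷ B ≫ φT =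
              (α_ sM.obj B B).hom ≫ sM.obj ◁ mu B ≫ coinvProj sB sM) ∧
          (∃! ρT : coinvTensor sB sM ⟶ coinvTensor sB sM ⊗ H,
            coinvProj sB sM ≫ ρT =
              sM.obj ◁ ρB ≫ (α_ sM.obj B H).inv ≫ coinvProj sB sM ▷ H) ∧
          (∃! ω : coinvTensor sB sM ⟶ M, coinvProj sB sM ≫ ω = sM.i ▷ B ≫ φM) ∧
          ∀ (φT : coinvTensor sB sM ⊗ B ⟶ coinvTensor sB sM)
            (ρT : coinvTensor sB sM ⟶ coinvTensor sB sM ⊗ H)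
            (ω : coinvTensor sB sM ⟶ M),
            coinvProj sB sM ▷ B ≫ φT =
              (α_ sM.obj B B).hom ≫ sM.obj ◁ mu B ≫ coinvProj sB sM →
            coinvProj sB sM ≫ ρT =
              sM.obj ◁ ρB ≫ (α_ sM.obj B H).inv ≫ coinvProj sB sM ▷ H →
            coinvProj sB sM ≫ ω = sM.i ▷ B ≫ φM →
            IsStrongHopfModule sB (coinvTensor sB sM) φT ρT ∧
            IsComoduleHom ρT ρM ω ∧
            IsComoduleHom ρM ρT (ρM ≫ (sM.p ⊗ₘ h) ≫ coinvProj sB sM) ∧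
            ω ≫ (ρM ≫ (sM.p ⊗ₘ h) ≫ coinvProj sB sM) = 𝟙 (coinvTensor sB sM) ∧
            (ρM ≫ (sM.p ⊗ₘ h) ≫ coinvProj sB sM) ≫ ω = 𝟙 M := by 
  have hBB := IsHopfAction.regular _hB _hh
  refine ⟨hBB.nonempty_splitting _hh, fun sB hmul hmul' M φM ρM hS ↦ ?_⟩
  have hM := hS.isHopfAction
  refine ⟨hM.nonempty_splitting _hh, fun sM ↦ ⟨coinvAct_i sB sM _hB _hh hM,
    existsUnique_tensorAct sB sM hmul', existsUnique_tensorCoact sB sM _hB _hh,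
    existsUnique_tensorMap sB sM _hB _hh hM hS.act_act, fun φT ρT ω hφ hρ hω ↦ ⟨?_,
      isComoduleHom_tensorMap sB sM _hh _hB hM hρ hω,
      isComoduleHom_tensorInv sB sM _hh hM hρ,
      tensorMap_comp_inv sB sM _hh _hB hM hS.act_act hω,
      tensorInv_comp_map sB sM _hh hM hω⟩⟩⟩
  have hT := isHopfAction_tensor sB sM _hB _hh hφ hρ
  exact ⟨hT.comodule, hT.act_one, tensorAct_assoc sB sM hmul hφ, hT.coact_act, hT.act_antipode,
    hT.antipode_act⟩
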